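/- Let $R$ be a commutative ring and let $\mathsf{FI}$ be the category of finite sets and injections; write $[n]$ for the standard set with $n$ elements. An $R$-valued $\mathsf{FI}$-module is a functor $M\colon \mathsf{FI}\to R\text{-}\mathsf{Mod}$, and $M_n := M_{[n]}$. It is \emph{presented in degrees $\le d$} if there is an exact sequence $\bigoplus_{j\in J} R\,\mathsf{FI}([b_j],-)\to\bigoplus_{i\in I} R\,\mathsf{FI}([a_i],-)\to M\to 0$ with all $a_i,b_j\le d$ (the index sets $I,J$ may be infinite). For $\ell\in\mathbb N$, let $\Xi(\ell)$ be the $\mathsf{FI}^{\mathrm{op}}$-module $\Xi(\ell)_S=H_0(X_S,A_S)$ (singular homology with integer coefficients), where $X_S=\mathrm{Emb}(S,[\ell]\sqcup\mathbb R)$ is the space of embeddings of the finite discrete space $S$ into $[\ell]\sqcup\mathbb R$, and $A_S\subseteq X_S$ is the subspace of those $\phi$ with $[\ell]\not\subseteq\operatorname{im}\phi$; injections act by precomposition. Let $A_\ell := M\otimes_{\mathsf{FI}}\Xi(\ell)$ be the functor tensor product, i.e. the $R$-module obtained from $\bigoplus_n M_n\otimes_{\mathbb Z}\Xi(\ell)_n$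 by dividing out the relations $M_f(m)\otimes\xi = m\otimes \Xi(\ell)_f(\xi)$ for all injections $f\colon[p]\to[q]$, $m\in M_p$, $\xi\in\Xi(\ell)_q$. \textbf{Theorem A.} Let $d\in\mathbb N$ and let $M$ be an $R$-valued $\mathsf{FI}$-module presented in degrees $\le d$. Then for all $n\ge 2d-1$ the integers $\binom n\ell-\binom n{\ell-1}$, $0\le\ell\le d$, are nonnegative (where $\binom n{-1}=0$), and there is an isomorphism of $R$-modules $$M_n\;\cong\;\bigoplus_{\ell=0}^{d} A_\ell^{\oplus\left(\binom n\ell-\binom n{\ell-1}\right)}.$$ In particular, if $R$ is a field and $M_n$ is finite-dimensional for all sufficiently large $n$, then $A_0,\dots,A_d$ are finite-dimensional, and there is exactly one polynomial $P\in\mathbb Q[x]$ with $\dim_R M_n=P(n)$ for all sufficiently large $n$ (the Hilbert polynomial of $M$), namely the nonnegative integer combination $$P(x)=\sum_{\ell=0}^{d}\dim_R(A_\ell)\left(\binom x\ell-\binom x{\ell-1}\right)$$ of the polynomials $\binom x\ell-\binom x{\ell-1}$, where $\binom x\ell = x(x-1)\cdots(x-\ell+1)/\ell!$ and $\binom x{-1}=0$.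 -/

import Mathlib

open CategoryTheory Filter
open scoped DirectSum TensorProduct Polynomial

universe u v

noncomputable section

/-- An object of the category `FI`: a finite set. -/
structure FI where
  /-- the underlying set -/
  carrier : Type
  [finite : Finite carrier]

namespace FI

/-- The category of finite sets and injections. -/
instance : Category FI where
  Hom S T := S.carrier ↪ T.carrier
  id S := Function.Embedding.refl S.carrier
  comp f g := Function.Embedding.trans f g

/-- The standard set with `n` elements, as an object of `FI`. -/
def std (n : ℕ) : FI := ⟨Fin n⟩

/-- The map of sets underlying a morphism of `FI`. -/
def toFun {S T : FI} (f : S ⟶ T) : S.carrier → T.carrier :=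
  (show S.carrier ↪ T.carrier from f)

theorem toFun_injective {S T : FI} (f : S ⟶ T) : Function.Injective (toFun f) :=
  (show S.carrier ↪ T.carrier from f).injective

end FI

/-! Generators and relations -/

section Presentation

variable {R : Type u} [CommRing R]

/-- The value at `S` of the free `R`-valued `FI`-module `⨁ i, R FI([a i], -)` on a family of
generators, the `i`-th one in degree `a i`: the free `R`-module on all pairs of an index `i` and an
injection `[a i] → S`. -/
abbrev FreeFI (R : Type u) [CommRing R] {I : Type v} (a : I → ℕ) (S : FI) : Type (max u v) :=
  (Σ i : I, (FI.std (a i) ⟶ S)) →₀ R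

/-- The action of an injection on the free `FI`-module, by postcomposition. -/
def FreeFI.map (R : Type u) [CommRing R] {I : Type v} (a : I → ℕ) {S T : FI} (f : S ⟶ T) :
    FreeFI R a S →ₗ[R] FreeFI R a T :=
  Finsupp.lmapDomain R R (fun p => ⟨p.1, p.2 ≫ f⟩)

/-- The map of `FI`-modules from the free `FI`-module to `M` that sends the `i`-th generator to the
element `g i` of `M` in degree `a i`. -/
def FreeFI.desc (M : FI ⥤ ModuleCat.{v} R) {I : Type v} (a : I → ℕ)
    (g : ∀ i, M.obj (FI.std (a i))) (S : FI) : FreeFI R a S →ₗ[R] M.obj S :=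
  Finsupp.linearCombination R (fun p => (M.map p.2).hom (g p.1))

/-- `M` is presented in degrees `≤ d`: there are (possibly infinite) families of generators `g i`
of degree `a i ≤ d` and of relations `r j` of degree `b j ≤ d` between them such that the `g i`
generate `M`, and all relations between the `g i` are consequences of the `r j`; that is, the
sequence `⨁ j, R FI([b j], -) → ⨁ i, R FI([a i], -) → M → 0` is exact. -/
def IsPresentedInDegreesLE (M : FI ⥤ ModuleCat.{v} R) (d : ℕ) : Prop :=
  ∃ (I : Type v) (a : I → ℕ) (g : ∀ i, M.obj (FI.std (a i)))
    (J : Type (max u v)) (b : J → ℕ) (r : ∀ j, FreeFI R a (FI.std (b j))),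
    (∀ i, a i ≤ d) ∧ (∀ j, b j ≤ d) ∧
    (∀ S : FI, Function.Surjective (FreeFI.desc M a g S)) ∧
    (∀ S : FI, LinearMap.ker (FreeFI.desc M a g S) =
      Submodule.span R {y | ∃ (j : J) (f : FI.std (b j) ⟶ S), y = FreeFI.map R a f (r j)})

end Presentation

/-! Zeroth relative homology -/

/-- Inside the group `C₀(X) = ℤ X` of singular `0`-chains: the subgroup `∂ C₁(X) + C₀(A)`, spanned
by the boundaries of the singular `1`-simplices (paths) of `X` and by the points of `A`. -/
def relBoundaries (X : Type) [TopologicalSpace X] (A : Set X) : Submodule ℤ (X →₀ ℤ) :=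
  Submodule.span ℤ
    ({z | ∃ (x y : X) (_ : Path x y), z = Finsupp.single y 1 - Finsupp.single x 1} ∪
      {z | ∃ x ∈ A, z = Finsupp.single x 1})

/-- The relative singular homology group `H₀(X, A)`, with coefficients in `ℤ`: the group of relative
`0`-chains `C₀(X) / C₀(A)` (all of which are cycles) modulo the boundaries of `1`-chains. -/
abbrev RelH0 (X : Type) [TopologicalSpace X] (A : Set X) : Type :=
  (X →₀ ℤ) ⧸ relBoundaries X A

/-- Functoriality of `H₀(X, A)` in the pair `(X, A)`. -/
def RelH0.map {X Y : Type} [TopologicalSpace X] [TopologicalSpace Y] {A : Set X} {B : Set Y}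
    (f : X → Y) (hf : Continuous f) (hAB : Set.MapsTo f A B) : RelH0 X A →ₗ[ℤ] RelH0 Y B :=
  Submodule.mapQ _ _ (Finsupp.lmapDomain ℤ ℤ f) (by
    rw [relBoundaries, Submodule.span_le]
    rintro z (⟨x, y, γ, rfl⟩ | ⟨x, hx, rfl⟩)
    · refine Submodule.subset_span (Or.inl ⟨f x, f y, γ.map hf, ?_⟩)
      rw [map_sub]
      simp only [Finsupp.lmapDomain_apply, Finsupp.mapDomain_single]
    · refine Submodule.subset_span (Or.inr ⟨f x, hAB hx, ?_⟩)
      simp [Finsupp.mapDomain_single])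

theorem RelH0.map_mk_single {X Y : Type} [TopologicalSpace X] [TopologicalSpace Y]
    {A : Set X} {B : Set Y} (f : X → Y) (hf : Continuous f) (hAB : Set.MapsTo f A B) (x : X) :
    RelH0.map f hf hAB (Submodule.Quotient.mk (Finsupp.single x 1)) =
      Submodule.Quotient.mk (Finsupp.single (f x) 1) := by
  simp [RelH0.map, Submodule.mapQ_apply, Finsupp.mapDomain_single]

theorem RelH0.hom_ext {X : Type} [TopologicalSpace X] {A : Set X} {P : Type} [AddCommGroup P]
    {f g : RelH0 X A →ₗ[ℤ] P}
    (h : ∀ x : X, f (Submodule.Quotient.mk (Finsupp.single x 1)) =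
      g (Submodule.Quotient.mk (Finsupp.single x 1))) : f = g := by
  apply Submodule.linearMap_qext
  apply Finsupp.lhom_ext'
  intro x
  apply LinearMap.ext_ring
  exact h x

/-! The `FI^op`-modules `Ξ(ℓ)` -/

/-- The space of embeddings of the finite discrete set `S` into `[ℓ] ⊔ ℝ`, topologized as a subspace
of the space of all maps. -/
abbrev EmbSpace (ℓ : ℕ) (S : FI) : Type :=
  {φ : S.carrier → Fin ℓ ⊕ ℝ // Function.Injective φ}

/-- The subspace of those embeddings whose image does not contain `[ℓ]`. -/
def EmbSpace.bad (ℓ : ℕ) (S : FI) : Set (EmbSpace ℓ S) :=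
  {φ | ¬ Set.range (Sum.inl : Fin ℓ → Fin ℓ ⊕ ℝ) ⊆ Set.range φ.1}

/-- Precomposition with an injection `S → T`. -/
def EmbSpace.precomp (ℓ : ℕ) {S T : FI} (f : S ⟶ T) (φ : EmbSpace ℓ T) : EmbSpace ℓ S :=
  ⟨φ.1 ∘ FI.toFun f, φ.2.comp (FI.toFun_injective f)⟩

theorem EmbSpace.continuous_precomp (ℓ : ℕ) {S T : FI} (f : S ⟶ T) :
    Continuous (EmbSpace.precomp ℓ f) := by
  refine Continuous.subtype_mk (f := fun φ : EmbSpace ℓ T => φ.1 ∘ FI.toFun f) ?_ _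
  exact continuous_pi fun s => (continuous_apply (FI.toFun f s)).comp continuous_subtype_val

theorem EmbSpace.mapsTo_precomp (ℓ : ℕ) {S T : FI} (f : S ⟶ T) :
    Set.MapsTo (EmbSpace.precomp ℓ f) (EmbSpace.bad ℓ T) (EmbSpace.bad ℓ S) := by
  intro φ hφ h
  refine hφ (h.trans ?_)
  rintro _ ⟨s, rfl⟩
  exact ⟨FI.toFun f s, rfl⟩

/-- The `FI^op`-module `Ξ(ℓ)`, with `Ξ(ℓ)_S = H₀(X_S, A_S)`, where `X_S` is the space of embeddings
of `S` into `[ℓ] ⊔ ℝ` and `A_S` is the subspace of embeddings whose image does not contain `[ℓ]`;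
injections act by precomposition. -/
def Xi (ℓ : ℕ) : FIᵒᵖ ⥤ ModuleCat.{0} ℤ where
  obj S := ModuleCat.of ℤ (RelH0 (EmbSpace ℓ S.unop) (EmbSpace.bad ℓ S.unop))
  map f := ModuleCat.ofHom (RelH0.map (EmbSpace.precomp ℓ f.unop)
    (EmbSpace.continuous_precomp ℓ f.unop) (EmbSpace.mapsTo_precomp ℓ f.unop))
  map_id S := by
    apply ModuleCat.hom_ext
    apply RelH0.hom_ext
    intro x
    exact RelH0.map_mk_single (EmbSpace.precomp ℓ (𝟙 S.unop)) (EmbSpace.continuous_precomp ℓ _)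
      (EmbSpace.mapsTo_precomp ℓ _) x
  map_comp f g := by
    apply ModuleCat.hom_ext
    apply RelH0.hom_ext
    intro x
    have h1 := RelH0.map_mk_single (EmbSpace.precomp ℓ f.unop)
      (EmbSpace.continuous_precomp ℓ f.unop) (EmbSpace.mapsTo_precomp ℓ f.unop) x
    have h2 := RelH0.map_mk_single (EmbSpace.precomp ℓ g.unop)
      (EmbSpace.continuous_precomp ℓ g.unop) (EmbSpace.mapsTo_precomp ℓ g.unop)
      (EmbSpace.precomp ℓ f.unop x)
    have h3 := RelH0.map_mk_single (EmbSpace.precomp ℓ (f ≫ g).unop)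
      (EmbSpace.continuous_precomp ℓ _) (EmbSpace.mapsTo_precomp ℓ _) x
    refine h3.trans ?_
    simp only [ModuleCat.hom_comp, ModuleCat.hom_ofHom, LinearMap.comp_apply]
    exact ((congrArg _ h1).trans h2).symm

/-! The functor tensor product and the tail invariants -/

section Tensor

variable {R : Type u} [CommRing R]

/-- The direct sum of the `M_n ⊗ N_n` over all `n`. -/
abbrev TensorSum (M : FI ⥤ ModuleCat.{v} R) (N : FIᵒᵖ ⥤ ModuleCat.{0} ℤ) : Type v :=
  ⨁ n : ℕ, (M.obj (FI.std n) ⊗[ℤ] N.obj (Opposite.op (FI.std n)))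

/-- The element `m ⊗ ξ` of the `n`-th summand. -/
def TensorSum.tmul (M : FI ⥤ ModuleCat.{v} R) (N : FIᵒᵖ ⥤ ModuleCat.{0} ℤ) (n : ℕ)
    (m : M.obj (FI.std n)) (ξ : N.obj (Opposite.op (FI.std n))) : TensorSum M N :=
  DirectSum.lof R ℕ
    (fun n : ℕ => (M.obj (FI.std n) ⊗[ℤ] N.obj (Opposite.op (FI.std n)))) n (m ⊗ₜ[ℤ] ξ)

/-- The functor tensor product `M ⊗_FI N`, an `R`-module: the quotient of `⨁ n, M_n ⊗ N_n` by the
relations `m f ⊗ ξ = m ⊗ f ξ` for all injections `f : [p] → [q]`, `m ∈ M_p` and `ξ ∈ N_q`. -/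
abbrev TensorFI (M : FI ⥤ ModuleCat.{v} R) (N : FIᵒᵖ ⥤ ModuleCat.{0} ℤ) : Type v :=
  TensorSum M N ⧸ Submodule.span R
    {z : TensorSum M N | ∃ (p q : ℕ) (f : FI.std p ⟶ FI.std q) (m : M.obj (FI.std p))
      (ξ : N.obj (Opposite.op (FI.std q))),
      z = TensorSum.tmul M N q ((M.map f).hom m) ξ - TensorSum.tmul M N p m ((N.map f.op).hom ξ)}

/-- The `ℓ`-th tail invariant `A_ℓ = M ⊗_FI Ξ(ℓ)`. -/
abbrev TailInvariant (M : FI ⥤ ModuleCat.{v} R) (ℓ : ℕ) : Type v := TensorFI M (Xi ℓ)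

end Tensor

/-! Differences of binomial coefficients, and Hilbert polynomials -/

/-- The integer `C(n, ℓ) - C(n, ℓ - 1)`, where `C(n, -1) = 0`. -/
def binomDiff (n : ℕ) : ℕ → ℤ
  | 0 => n.choose 0
  | ℓ + 1 => n.choose (ℓ + 1) - n.choose ℓ

/-- The binomial coefficient `C(X, ℓ) = X (X - 1) ⋯ (X - ℓ + 1) / ℓ!` as a polynomial. -/
def binomPoly (ℓ : ℕ) : ℚ[X] := Polynomial.C ((ℓ.factorial : ℚ)⁻¹) * descPochhammer ℚ ℓ

/-- The polynomial `C(X, ℓ) - C(X, ℓ - 1)`, where `C(X, -1) = 0`. -/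
def binomDiffPoly : ℕ → ℚ[X]
  | 0 => binomPoly 0
  | ℓ + 1 => binomPoly (ℓ + 1) - binomPoly ℓ

/-- `P` is a Hilbert polynomial of `M`: it eventually coincides with the Hilbert function
`n ↦ dim M_n`. -/
def IsHilbertPolynomial {R : Type u} [CommRing R] (M : FI ⥤ ModuleCat.{v} R) (P : ℚ[X]) : Prop :=
  ∀ᶠ n : ℕ in atTop, (Module.finrank R (M.obj (FI.std n)) : ℚ) = P.eval (n : ℚ)

end

/-! By Yoneda, `M_n = M ⊗_FI ℤ FI(-, [n])`, and for `M` presented in degrees `≤ d` the tensor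
product `M ⊗_FI N` depends only on `N` in degrees `≤ d`. So it suffices to split the representable
module in these degrees. A standard Young tableau with `n` entries and second row of length `ℓ`
defines an embedding `[n] → [ℓ] ⊔ ℝ` (`Filling.emb`); its class in `Ξ(ℓ)_n` corresponds to a map `ℤ
FI(-, [n]) → Ξ(ℓ)`. For `n ≥ 2d - 1`, these maps for all tableaux with `ℓ ≤ d` together are
bijective in degrees `≤ d` (`bijective_yonedaPi_xi`), and `C(n, ℓ) - C(n, ℓ - 1)` of the tableaux
belong to `ℓ` (`Filling.card_isBallot`).

The groups `Ξ(ℓ)_k` are combinatorial: `[ℓ]` comes before `ℝ`, so an embedding of `[k]` that covers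
`[ℓ]` is determined up to a path by the word that lists `[k]` in the order of the images.
Bijectivity is tested on homomorphisms to an arbitrary group `B`: each `B`-valued function on
injections `[k] → [n]` must be, in exactly one way, a sum over tableaux of functions of the words
read off. An injection is a labelling of `k` of the numbers `0, …, n - 1`. If repeated labels are
allowed, the label set stays fixed when the last number is removed, and induction on `n` yields
existence (`Filling.exists_pairing_eq`) and uniqueness (`Filling.eq_zero_of_pairing_eq_zero`),
refining Pascal's rule.

The passage from the representable module to `M_n` is `bijective_toTensorPi`. The Hilbert polynomial
follows by taking dimensions. -/

noncomputable section

/-! Fillings of two-row diagrams -/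

/-- A filling of a diagram with two rows by the numbers `0, …, n - 1`, increasing along the rows:
for each number, the row that contains it. -/
def Filling : ℕ → Type
  | 0 => Unit
  | n + 1 => Filling n ⊕ Filling n

namespace Filling

instance fintype : ∀ n, Fintype (Filling n)
  | 0 => inferInstanceAs (Fintype Unit)
  | n + 1 => letI := fintype n; inferInstanceAs (Fintype (Filling n ⊕ Filling n))

/-- The length of the second row. -/
def deg : ∀ {n}, Filling n → ℕ
  | 0, _ => 0
  | _ + 1, .inl t => deg t
  | _ + 1, .inr t => deg t + 1

/-- The filling is a standard Young tableau. -/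
def IsBallot : ∀ {n}, Filling n → Prop
  | 0, _ => True
  | _ + 1, .inl t => IsBallot t
  | n + 1, .inr t => IsBallot t ∧ 2 * (deg t + 1) ≤ n + 1

theorem IsBallot.two_mul_deg_le : ∀ {n} {t : Filling n}, IsBallot t → 2 * deg t ≤ n
  | 0, _, _ => le_rfl
  | n + 1, .inl t, h => (two_mul_deg_le (n := n) (t := t) h).trans n.le_succ
  | _ + 1, .inr _, h => h.2

/-- The standard Young tableaux that are relevant for words of length `k`. -/
def Admissible {n : ℕ} (k : ℕ) (t : Filling n) : Prop :=
  IsBallot t ∧ deg t ≤ k ∧ deg t + k ≤ n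

theorem admissible_inl {n k : ℕ} (t : Filling n) :
    Admissible (n := n + 1) k (.inl t) ↔ IsBallot t ∧ deg t ≤ k ∧ deg t + k ≤ n + 1 := Iff.rfl

/-- The ballot inequality of the last step is redundant: it follows by adding the two bounds that
involve `k`. -/
theorem admissible_inr {n k : ℕ} (t : Filling n) :
    Admissible (n := n + 1) k (.inr t) ↔ IsBallot t ∧ deg t + 1 ≤ k ∧ deg t + k ≤ n := by
  change (IsBallot t ∧ 2 * (deg t + 1) ≤ n + 1) ∧ deg t + 1 ≤ k ∧ deg t + 1 + k ≤ n + 1 ↔ _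
  constructor
  · rintro ⟨⟨h1, h2⟩, h3, h4⟩; exact ⟨h1, h3, by omega⟩
  · rintro ⟨h1, h3, h4⟩; exact ⟨⟨h1, by omega⟩, h3, by omega⟩

/-! ### Functions on labellings and functions on words -/

variable {α : Type*} {B : Type*} [AddCommGroup B]

/-- The word that is read off from a partially defined `α`-valued labelling `v` of the numbers
`0, …, n - 1`: the labels in the second row, from right to left, followed by those in the first
row. It is only defined if all entries of the second row have a label. -/
def word : ∀ {n}, Filling n → (Fin n → Option α) → Option (List α)
  | 0, _, _ => some []
  | n + 1, .inl t, v => (v (Fin.last n)).elim (word t (v ∘ Fin.castSucc))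
      fun s => (word t (v ∘ Fin.castSucc)).map (· ++ [s])
  | n + 1, .inr t, v => (v (Fin.last n)).elim none
      fun s => (word t (v ∘ Fin.castSucc)).map (s :: ·)

/-- The number of labels. -/
def size {n : ℕ} (v : Fin n → Option α) : ℕ := ∑ p, if (v p).isSome then 1 else 0

theorem size_succ {n : ℕ} (v : Fin (n + 1) → Option α) :
    size v = size (v ∘ Fin.castSucc) + if (v (Fin.last n)).isSome then 1 else 0 := by
  simp only [size, Fin.sum_univ_castSucc, Function.comp]

theorem sum_succ {n : ℕ} (F : Filling (n + 1) → B) :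
    ∑ t, F t = ∑ t : Filling n, F (.inl t) + ∑ t : Filling n, F (.inr t) :=
  Fintype.sum_sum_type F

/-- The value at `v` of the function on labellings that is given by functions on words. -/
def pairing {n : ℕ} (y : Filling n → List α → B) (v : Fin n → Option α) : B :=
  ∑ t, (word t v).elim 0 (y t)

theorem pairing_of_last_eq_none {n : ℕ} (y : Filling (n + 1) → List α → B)
    (v : Fin (n + 1) → Option α) (hv : v (Fin.last n) = none) :
    pairing y v = pairing (fun t : Filling n => y (.inl t)) (v ∘ Fin.castSucc) := by
  simp [pairing, sum_succ, word, hv]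

/-- The label of the last number ends the word if that number is in the first row, and starts it if
it is in the second. Both inductions below run on this recursion. -/
theorem pairing_of_last_eq_some {n : ℕ} (y : Filling (n + 1) → List α → B)
    (v : Fin (n + 1) → Option α) {s : α} (hv : v (Fin.last n) = some s) :
    pairing y v = pairing (fun (t : Filling n) l => y (.inl t) (l ++ [s]) + y (.inr t) (s :: l))
      (v ∘ Fin.castSucc) := by
  simp only [pairing, sum_succ, word, hv, Option.elim_some, ← Finset.sum_add_distrib]
  refine Finset.sum_congr rfl fun t _ => ?_
  cases word t (v ∘ Fin.castSucc) <;> simp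

theorem pairing_add {n : ℕ} (y z : Filling n → List α → B) (v : Fin n → Option α) :
    pairing (fun t l => y t l + z t l) v = pairing y v + pairing z v := by
  simp only [pairing, ← Finset.sum_add_distrib]
  refine Finset.sum_congr rfl fun t _ => ?_
  cases word t v <;> simp

theorem pairing_sub {n : ℕ} (y z : Filling n → List α → B) (v : Fin n → Option α) :
    pairing (fun t l => y t l - z t l) v = pairing y v - pairing z v := by
  simp only [pairing, ← Finset.sum_sub_distrib]
  refine Finset.sum_congr rfl fun t _ => ?_
  cases word t v <;> simp

/-- Induction on `n`, splitting labellings by the label of the last number. This gives two linear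
conditions on the functions for the two positions of that number, and the system is triangular after
a change of variables that depends on `k`. -/
theorem exists_pairing_eq (n : ℕ) : ∀ (k : ℕ) (h : (Fin n → Option α) → B),
    ∃ y : Filling n → List α → B, (∀ t l, ¬ Admissible k t → y t l = 0) ∧
      ∀ v, size v = k → pairing y v = h v := by
  induction n with
  | zero =>
    intro k h
    by_cases hk : k = 0
    · subst hk
      refine ⟨fun _ _ => h Fin.elim0, fun t l ht => absurd ⟨trivial, le_rfl, le_rfl⟩ ht, ?_⟩
      intro v _
      rw [Subsingleton.elim v Fin.elim0]
      exact Fintype.sum_unique (ι := Unit) _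
    · refine ⟨fun _ _ => 0, fun _ _ _ => rfl, fun v hv => absurd hv.symm hk⟩
  | succ n ih =>
    intro k h
    -- If `2k ≤ n + 1`, the admissible tableaux ending in the first or second row restrict to the
    -- admissible ones for `(n, k)` or `(n, k - 1)`, respectively. If `2k > n + 1`, the two roles
    -- are exchanged.
    by_cases hk : 2 * k ≤ n + 1
    · obtain ⟨a, ha, ha'⟩ := ih k fun v => h (Fin.snoc (α := fun _ => Option α) v none)
      choose z hz hz' using fun s : α => ih (k - 1) fun v =>
        h (Fin.snoc (α := fun _ => Option α) v (some s)) -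
          pairing (fun t l => a t (l ++ [s])) v
      -- The empty word never occurs when the last number is in the second row. For `k = 0` no such
      -- filling is admissible, and truncation `k - 1 = 0` would spoil the support condition, hence
      -- the value `0`.
      refine ⟨fun t l => Sum.elim (fun t => a t l)
        (fun t => match l with | [] => 0 | s :: l => if k = 0 then 0 else z s t l) t, ?_, ?_⟩
      · rintro (t | t) l ht
        · refine ha t l fun h' => ht ((admissible_inl t).2 ⟨h'.1, h'.2.1, ?_⟩)
          have := h'.2.2
          omega
        · rcases l with - | ⟨s, l⟩
          · rfl
          · change (if k = 0 then 0 else z s t l) = 0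
            split_ifs with hk0
            · rfl
            refine hz s t l fun h' => ht ((admissible_inr t).2 ⟨h'.1, ?_, ?_⟩) <;>
            · have := h'.2.1
              omega
      · intro v hv
        rw [size_succ] at hv
        rcases hl : v (Fin.last n) with - | s
        · rw [pairing_of_last_eq_none _ _ hl]
          refine (ha' (v ∘ Fin.castSucc) (by simpa [hl] using hv)).trans ?_
          rw [← hl]
          exact congrArg h (Fin.snoc_init_self v)
        · rw [pairing_of_last_eq_some _ _ hl]
          simp only [hl, Option.isSome_some, if_true] at hv
          have hk0 : k ≠ 0 := by omega
          simp only [Sum.elim_inl, Sum.elim_inr, if_neg hk0]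
          refine (pairing_add (fun t l => a t (l ++ [s])) (z s) _).trans ?_
          rw [hz' s _ (by omega), ← hl, add_sub_cancel]
          exact congrArg h (Fin.snoc_init_self v)
    · choose c hc hc' using fun s : α => ih (k - 1) fun v =>
        h (Fin.snoc (α := fun _ => Option α) v (some s))
      -- The sum of the two functions, after moving the letter `s` from the front to the end of the
      -- word, is prescribed by the labellings whose last label is `s`. The function `e` then
      -- distributes it over the two rows, so that the unlabelled case holds as well.
      let y' : Filling n → List α → B := fun t l =>
        (l.getLast?).elim 0 fun s => c s t l.dropLast
      obtain ⟨e, he, he'⟩ := ih k fun v =>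
        pairing y' v - h (Fin.snoc (α := fun _ => Option α) v none)
      refine ⟨fun t l => Sum.elim (fun t => y' t l - e t l)
        (fun t => match l with | [] => 0 | s :: l => e t (l ++ [s])) t, ?_, ?_⟩
      · rintro (t | t) l ht
        · rw [admissible_inl] at ht
          have h1 : e t l = 0 := he t l fun h' => ht ⟨h'.1, h'.2.1, by have := h'.2.2; omega⟩
          have h2 : y' t l = 0 := by
            rcases hl : l.getLast? with - | s
            · simp [y', hl]
            · simp only [y', hl, Option.elim_some]
              exact hc s t _ fun h' => ht ⟨h'.1, by have := h'.2.1; omega,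
                by have := h'.2.2; omega⟩
          change y' t l - e t l = 0
          rw [h1, h2, sub_zero]
        · rcases l with - | ⟨s, l⟩
          · rfl
          · exact he t _ fun h' => ht ((admissible_inr t).2 ⟨h'.1, by have := h'.2.2; omega,
              by have := h'.2.2; omega⟩)
      · intro v hv
        rw [size_succ] at hv
        rcases hl : v (Fin.last n) with - | s
        · rw [pairing_of_last_eq_none _ _ hl]
          refine (pairing_sub y' e _).trans ?_
          rw [he' _ (by simpa [hl] using hv), sub_sub_cancel, ← hl]
          exact congrArg h (Fin.snoc_init_self v)
        · rw [pairing_of_last_eq_some _ _ hl]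
          simp only [hl, Option.isSome_some, if_true] at hv
          simp only [Sum.elim_inl, Sum.elim_inr, sub_add_cancel]
          have : (fun (t : Filling n) (l : List α) => y' t (l ++ [s])) = c s := by
            funext t l
            simp [y']
          rw [this, hc' s _ (by omega), ← hl]
          exact congrArg h (Fin.snoc_init_self v)

/-- The triangular systems of the existence proof also have at most one solution. Values on words of
other lengths are not seen by the pairing with labellings of size `k`, so they have to vanish by
assumption. -/
theorem eq_zero_of_pairing_eq_zero (n : ℕ) : ∀ (k : ℕ) (y : Filling n → List α → B),
    (∀ t l, ¬ Admissible k t → y t l = 0) → (∀ t l, l.length ≠ k → y t l = 0) →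
    (∀ v, size v = k → pairing y v = 0) → ∀ t l, y t l = 0 := by
  induction n with
  | zero =>
    intro k y h1 h2 h3 t l
    by_cases hl : l.length = k
    swap
    · exact h2 t l hl
    by_cases hk : k = 0
    · subst hk
      rw [List.length_eq_zero_iff] at hl
      subst hl
      rw [← h3 Fin.elim0 rfl]
      exact (Fintype.sum_unique (ι := Unit) fun t => y t []).symm
    · exact h1 t l fun h => hk (by have := h.2.2; omega)
  | succ n ih =>
    intro k y h1 h2 h3
    have hnone : ∀ v : Fin n → Option α, size v = k →
        pairing (fun t : Filling n => y (.inl t)) v = 0 := by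
      intro v hv
      have h := h3 (Fin.snoc (α := fun _ => Option α) v none) (by
        rw [size_succ]; simpa [Function.comp_def] using hv)
      rw [pairing_of_last_eq_none _ _ (by simp)] at h
      simpa [Function.comp_def] using h
    have hsome : ∀ (s : α) (v : Fin n → Option α), size v + 1 = k →
        pairing (fun (t : Filling n) l => y (.inl t) (l ++ [s]) + y (.inr t) (s :: l)) v = 0 := by
      intro s v hv
      have h := h3 (Fin.snoc (α := fun _ => Option α) v (some s)) (by
        rw [size_succ]; simpa [Function.comp_def] using hv)
      rw [pairing_of_last_eq_some _ _ (s := s) (by simp)] at h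
      simpa [Function.comp_def] using h
    by_cases hk : 2 * k ≤ n + 1
    · have hl : ∀ t l, y (.inl t) l = 0 := by
        refine ih k _ (fun t l ht => h1 _ l fun h' => ht ?_) (fun t l => h2 _ l) hnone
        rw [admissible_inl] at h'
        have := h'.1.two_mul_deg_le
        exact ⟨h'.1, h'.2.1, by omega⟩
      have hr : ∀ t l, y (.inr t) l = 0 := by
        rintro t (- | ⟨s, l⟩)
        · by_cases hk0 : k = 0
          · exact h1 _ _ fun h' => by have := (admissible_inr t).1 h'; omega
          · exact h2 _ _ fun h => hk0 h.symm
        by_cases hk0 : k = 0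
        · exact h2 _ _ (by simp [hk0])
        refine ih (k - 1) (fun t l => y (.inr t) (s :: l)) ?_ ?_ ?_ t l
        · refine fun t l ht => h1 _ _ fun h' => ht ?_
          rw [admissible_inr] at h'
          exact ⟨h'.1, by omega, by omega⟩
        · exact fun t l hl => h2 _ _ (by rw [List.length_cons]; omega)
        · intro v hv
          simpa [hl] using hsome s v (by omega)
      rintro (t | t) l
      exacts [hl t l, hr t l]
    -- Now the sums are supported on tableaux admissible for `(n, k - 1)`, so they vanish first; the
    -- support of the second-row part then restricts that of the first-row part.
    · have hsum : ∀ t l s, y (.inl t) (l ++ [s]) + y (.inr t) (s :: l) = 0 := by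
        intro t l s
        refine ih (k - 1) (fun t l => y (.inl t) (l ++ [s]) + y (.inr t) (s :: l)) ?_ ?_ ?_ t l
        · intro t l ht
          rw [h1 (.inl t), h1 (.inr t), add_zero]
          · refine fun h' => ht ?_
            rw [admissible_inr] at h'
            exact ⟨h'.1, by omega, by omega⟩
          · refine fun h' => ht ?_
            rw [admissible_inl] at h'
            exact ⟨h'.1, by omega, by omega⟩
        · intro t l hl
          rw [h2 (.inl t), h2 (.inr t), add_zero]
          · rw [List.length_cons]; omega
          · rw [List.length_append, List.length_singleton]; omega
        · exact fun v hv => hsome s v (by omega)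
      have hl : ∀ t l, y (.inl t) l = 0 := by
        refine ih k _ (fun t l ht => ?_) (fun t l => h2 _ l) hnone
        rcases l.eq_nil_or_concat with rfl | ⟨l, s, rfl⟩
        · exact h2 _ _ (by rw [List.length_nil]; omega)
        · have h0 : y (.inr t) (s :: l) = 0 := h1 _ _ fun h' => ht (by
            rw [admissible_inr] at h'
            exact ⟨h'.1, by omega, by omega⟩)
          have := hsum t l s
          rw [h0, add_zero] at this
          simpa using this
      rintro (t | t) l
      · exact hl t l
      · rcases l with - | ⟨s, l⟩
        · exact h2 _ _ (by rw [List.length_nil]; omega)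
        · simpa [hl] using hsum t l s

/-- The number of standard Young tableaux with `n` entries and second row of length `ℓ`. -/
theorem card_isBallot (n : ℕ) : ∀ ℓ, 2 * ℓ ≤ n + 1 →
    (Nat.card {t : Filling n // IsBallot t ∧ deg t = ℓ} : ℤ) = binomDiff n ℓ := by
  induction n with
  | zero =>
    intro ℓ hℓ
    obtain rfl : ℓ = 0 := by omega
    have : Unique {t : Filling 0 // IsBallot t ∧ deg t = 0} :=
      { default := ⟨(() : Unit), trivial, rfl⟩, uniq := fun _ => Subtype.ext rfl }
    simp [binomDiff]
  | succ n ih =>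
    intro ℓ hℓ
    -- The boundary case, outside the range of the induction hypothesis: there is no tableau, and
    -- the two middle binomial coefficients agree.
    by_cases hb : 2 * ℓ = n + 1 + 1
    · obtain ⟨ℓ, rfl⟩ : ∃ m, ℓ = m + 1 := ⟨ℓ - 1, by omega⟩
      obtain rfl : n = 2 * ℓ := by omega
      have : IsEmpty {t : Filling (2 * ℓ + 1) // IsBallot t ∧ deg t = ℓ + 1} :=
        ⟨fun t => by have := t.2.1.two_mul_deg_le; have := t.2.2; omega⟩
      rw [Nat.card_of_isEmpty, binomDiff, Nat.choose_symm_half, sub_self, Nat.cast_zero]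
    have e : {t : Filling (n + 1) // IsBallot t ∧ deg t = ℓ} ≃
        {t : Filling n // IsBallot t ∧ deg t = ℓ} ⊕
          {t : Filling n // IsBallot t ∧ deg t + 1 = ℓ} :=
      (Equiv.subtypeSum (α := Filling n) (β := Filling n)
        (p := fun t : Filling (n + 1) => IsBallot t ∧ deg t = ℓ)).trans
        (Equiv.sumCongr (Equiv.refl _) (Equiv.subtypeEquivRight fun t => by
          change (IsBallot t ∧ 2 * (deg t + 1) ≤ n + 1) ∧ deg t + 1 = ℓ ↔ _
          constructor
          · exact fun h => ⟨h.1.1, h.2⟩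
          · exact fun h => ⟨⟨h.1, by omega⟩, h.2⟩))
    rw [Nat.card_congr e, Nat.card_sum, Nat.cast_add]
    rcases ℓ with - | ℓ
    · rw [ih 0 (by omega)]
      simp [binomDiff]
    · have h1 : (Nat.card {t : Filling n // IsBallot t ∧ deg t = ℓ + 1} : ℤ) =
          binomDiff n (ℓ + 1) := ih _ (by omega)
      have h2 := ih ℓ (by omega)
      simp only [add_left_inj]
      rw [h1, h2]
      rcases ℓ with - | ℓ
      · simp [binomDiff]
      · simp only [binomDiff, Nat.choose_succ_succ' n]
        push_cast
        ring

end Filling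

/-! Path components of spaces of embeddings -/

namespace EmbSpace

variable {ℓ : ℕ} {S : FI}

theorem notMem_bad_iff {ψ : EmbSpace ℓ S} : ψ ∉ bad ℓ S ↔ ∀ j, ∃ a, ψ.1 a = Sum.inl j := by
  simp [bad, Set.range_subset_iff]

/-- The elements of `S` are listed in the order of their images in `[ℓ] ⊔ ℝ`, where all elements
of `[ℓ]` come first. -/
def IsWord (ψ : EmbSpace ℓ S) (l : List S.carrier) : Prop :=
  (∀ a, a ∈ l) ∧ l.Pairwise fun a b => toLex (ψ.1 a) < toLex (ψ.1 b)

theorem IsWord.nodup {ψ : EmbSpace ℓ S} {l : List S.carrier} (h : IsWord ψ l) : l.Nodup :=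
  h.2.imp fun hab => by rintro rfl; exact lt_irrefl _ hab

theorem exists_isWord (ψ : EmbSpace ℓ S) : ∃ l, IsWord ψ l := by
  have := S.finite
  let := Fintype.ofFinite S.carrier
  let : LinearOrder S.carrier :=
    LinearOrder.lift' (fun a => toLex (ψ.1 a)) (toLex.injective.comp ψ.2)
  exact ⟨Finset.univ.sort (· ≤ ·), fun a => by simp,
    (Finset.sortedLT_sort (Finset.univ : Finset S.carrier)).pairwise⟩

theorem IsWord.unique {ψ : EmbSpace ℓ S} {l l' : List S.carrier} (h : IsWord ψ l)
    (h' : IsWord ψ l') : l = l' :=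
  List.Perm.eq_of_pairwise (fun _ _ _ _ h1 h2 => absurd h1 h2.asymm) h.2 h'.2
    ((List.perm_ext_iff_of_nodup h.nodup h'.nodup).2 fun a => by simp [h.1 a, h'.1 a])

/-- The list of the elements of `S` in the order of their images. -/
def word (ψ : EmbSpace ℓ S) : List S.carrier := Classical.choose (exists_isWord ψ)

theorem isWord_word (ψ : EmbSpace ℓ S) : IsWord ψ (word ψ) := Classical.choose_spec _

theorem IsWord.lt_of_lt {ψ ψ' : EmbSpace ℓ S} {l : List S.carrier} (h : IsWord ψ l)
    (h' : IsWord ψ' l) {a b : S.carrier} (hab : toLex (ψ.1 a) < toLex (ψ.1 b)) :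
    toLex (ψ'.1 a) < toLex (ψ'.1 b) := by
  -- Symmetrized, so that a property of pairs in list order extends to all pairs.
  let r : S.carrier → S.carrier → Prop := fun a b =>
    (toLex (ψ.1 a) < toLex (ψ.1 b) → toLex (ψ'.1 a) < toLex (ψ'.1 b)) ∧
      (toLex (ψ.1 b) < toLex (ψ.1 a) → toLex (ψ'.1 b) < toLex (ψ'.1 a))
  have : Std.Symm r := ⟨fun _ _ h => ⟨h.2, h.1⟩⟩
  have hr : l.Pairwise r := (h.2.and h'.2).imp fun h =>
    ⟨fun _ => h.2, fun h'' => absurd h'' h.1.asymm⟩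
  exact (List.Pairwise.forall_of_forall (R := r)
    (fun x _ => ⟨fun h => absurd h (lt_irrefl _), fun h => absurd h (lt_irrefl _)⟩)
    hr (h.1 a) (h.1 b)).1 hab

/-- Both embeddings cover `[ℓ]`, which lies below `ℝ`; so the `j`-th element of `S` in the common
order goes to `j` under both. This is why the word alone determines the path component outside
`A_S`. -/
theorem eq_inl_of_forall_lt {ψ ψ' : EmbSpace ℓ S} (hψ : ψ ∉ bad ℓ S) (hψ' : ψ' ∉ bad ℓ S)
    (h : ∀ a b, toLex (ψ.1 a) < toLex (ψ.1 b) → toLex (ψ'.1 a) < toLex (ψ'.1 b)) :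
    ∀ (j : Fin ℓ) (b : S.carrier), ψ.1 b = Sum.inl j → ψ'.1 b = Sum.inl j := by
  rw [notMem_bad_iff] at hψ hψ'
  intro j
  induction j using WellFoundedLT.induction with
  | _ j ih =>
  intro b hb
  obtain ⟨b', hb'⟩ := hψ' j
  by_cases hbb : b' = b
  · rwa [hbb] at hb'
  exfalso
  rcases lt_trichotomy (toLex (ψ.1 b')) (toLex (ψ.1 b)) with h1 | h1 | h1
  · rcases hi : ψ.1 b' with i | x
    · rw [hi, hb, Sum.Lex.inl_lt_inl_iff] at h1
      have := ih i h1 b' hi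
      rw [hb', Sum.inl.injEq] at this
      exact h1.ne this.symm
    · rw [hi, hb] at h1
      exact Sum.Lex.not_inr_lt_inl h1
  · exact hbb (ψ.2 (toLex.injective h1))
  · have h2 := h _ _ h1
    rcases hi : ψ'.1 b with i | x
    · rw [hi, hb', Sum.Lex.inl_lt_inl_iff] at h2
      obtain ⟨c, hc⟩ := hψ i
      obtain rfl : c = b := ψ'.2 ((ih i h2 c hc).trans hi.symm)
      rw [hb, Sum.inl.injEq] at hc
      exact h2.ne hc.symm
    · rw [hi, hb'] at h2
      exact Sum.Lex.not_inr_lt_inl h2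

/-! ### Invariance of the order along paths -/

theorem isOpen_toLex_lt (ℓ : ℕ) :
    IsOpen {z : (Fin ℓ ⊕ ℝ) × (Fin ℓ ⊕ ℝ) | toLex z.1 < toLex z.2} := by
  rw [isOpen_iff_forall_mem_open]
  rintro ⟨x | x, y | y⟩ h
  · refine ⟨{Sum.inl x} ×ˢ {Sum.inl y}, ?_, ?_, by simp⟩
    · rintro ⟨_, _⟩ ⟨rfl, rfl⟩; exact h
    · have : ∀ i : Fin ℓ, IsOpen {(Sum.inl i : Fin ℓ ⊕ ℝ)} := fun i => by
        simpa using (Topology.IsOpenEmbedding.inl (X := Fin ℓ) (Y := ℝ)).isOpenMap {i}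
          (isOpen_discrete _)
      exact (this x).prod (this y)
  · refine ⟨Set.range Sum.inl ×ˢ Set.range Sum.inr, ?_, isOpen_range_inl.prod isOpen_range_inr,
      by simp⟩
    rintro ⟨_, _⟩ ⟨⟨i, rfl⟩, ⟨z, rfl⟩⟩
    exact Sum.Lex.inl_lt_inr _ _
  · exact absurd h Sum.Lex.not_inr_lt_inl
  · refine ⟨Prod.map Sum.inr Sum.inr '' {z : ℝ × ℝ | z.1 < z.2}, ?_, ?_, ?_⟩
    · rintro _ ⟨z, hz, rfl⟩
      exact Sum.Lex.inr_lt_inr_iff.2 hz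
    · exact (Topology.IsOpenEmbedding.inr.prodMap Topology.IsOpenEmbedding.inr).isOpenMap _
        (isOpen_lt continuous_fst continuous_snd)
    · exact ⟨(x, y), Sum.Lex.inr_lt_inr_iff.1 h, rfl⟩

/-- By injectivity, the complement is the open set with `a` and `b` exchanged, unless `a = b`. -/
theorem isClopen_setOf_lt (a b : S.carrier) :
    IsClopen {ψ : EmbSpace ℓ S | toLex (ψ.1 a) < toLex (ψ.1 b)} := by
  have hc : ∀ a : S.carrier, Continuous fun ψ : EmbSpace ℓ S => ψ.1 a := fun a =>
    (continuous_apply a).comp continuous_subtype_val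
  have ho : ∀ a b, IsOpen {ψ : EmbSpace ℓ S | toLex (ψ.1 a) < toLex (ψ.1 b)} := fun a b =>
    (isOpen_toLex_lt ℓ).preimage ((hc a).prodMk (hc b))
  refine ⟨?_, ho a b⟩
  by_cases hab : a = b
  · subst hab
    simp
  · convert (ho b a).isClosed_compl using 1
    ext ψ
    simp only [Set.mem_ofPred_eq, Set.mem_compl_iff, not_lt]
    exact (lt_iff_le_and_ne.trans
      (and_iff_left fun h => hab (ψ.2 (toLex.injective h))))

theorem isClopen_setOf_eq_inl (a : S.carrier) (j : Fin ℓ) :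
    IsClopen {ψ : EmbSpace ℓ S | ψ.1 a = Sum.inl j} := by
  have hc : Continuous fun ψ : EmbSpace ℓ S => ψ.1 a :=
    (continuous_apply a).comp continuous_subtype_val
  refine IsClopen.preimage (s := {Sum.inl j}) ⟨isClosed_singleton, ?_⟩ hc
  simpa using (Topology.IsOpenEmbedding.inl (X := Fin ℓ) (Y := ℝ)).isOpenMap {j}
    (isOpen_discrete _)

theorem _root_.Path.mem_iff_of_isClopen {X : Type*} [TopologicalSpace X] {x y : X} (γ : Path x y)
    {s : Set X} (hs : IsClopen s) : x ∈ s ↔ y ∈ s := by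
  have h : ∀ {x y : X}, Path x y → x ∈ s → y ∈ s := fun γ hx =>
    (isPreconnected_range γ.continuous).subset_isClopen hs
      ⟨_, ⟨0, γ.source⟩, hx⟩ ⟨1, γ.target⟩
  exact ⟨h γ, h γ.symm⟩

theorem mem_bad_iff_of_path {ψ ψ' : EmbSpace ℓ S} (γ : Path ψ ψ') :
    ψ ∈ bad ℓ S ↔ ψ' ∈ bad ℓ S := by
  rw [← not_iff_not, notMem_bad_iff, notMem_bad_iff]
  exact forall_congr' fun j => exists_congr fun a =>
    γ.mem_iff_of_isClopen (isClopen_setOf_eq_inl a j)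

theorem word_eq_of_path {ψ ψ' : EmbSpace ℓ S} (γ : Path ψ ψ') : word ψ = word ψ' := by
  refine IsWord.unique (ψ := ψ') ⟨(isWord_word ψ).1, (isWord_word ψ).2.imp ?_⟩ (isWord_word ψ')
  exact fun {a b} => (γ.mem_iff_of_isClopen (isClopen_setOf_lt a b)).1

/-- The straight path between two embeddings that agree on the preimage of `[ℓ]` and order the
other points in the same way. -/
theorem exists_path {ψ ψ' : EmbSpace ℓ S}
    (h : ∀ a b, toLex (ψ.1 a) < toLex (ψ.1 b) → toLex (ψ'.1 a) < toLex (ψ'.1 b))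
    (h1 : ∀ j a, ψ.1 a = Sum.inl j → ψ'.1 a = Sum.inl j)
    (h2 : ∀ j a, ψ'.1 a = Sum.inl j → ψ.1 a = Sum.inl j) : Nonempty (Path ψ ψ') := by
  -- The default `0` is never used: by `h2`, points that `ψ` sends to `ℝ` are sent to `ℝ` by `ψ'`.
  let G : ℝ → S.carrier → Fin ℓ ⊕ ℝ := fun τ a => (ψ.1 a).elim Sum.inl
    fun x => Sum.inr ((1 - τ) * x + τ * (ψ'.1 a).elim (fun _ => (0 : ℝ)) id)
  have hlt : ∀ τ : unitInterval, ∀ a b, toLex (ψ.1 a) < toLex (ψ.1 b) →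
      toLex (G τ a) < toLex (G τ b) := by
    rintro ⟨τ, h0, h1'⟩ a b hab
    have hab' := h _ _ hab
    simp only [G]
    rcases ha : ψ.1 a with i | x <;> rcases hb : ψ.1 b with j | y <;> rw [ha, hb] at hab
    · exact hab
    · exact Sum.Lex.inl_lt_inr _ _
    · exact absurd hab Sum.Lex.not_inr_lt_inl
    · rcases ha' : ψ'.1 a with i | x'
      · exact absurd (h2 _ _ ha') (by simp [ha])
      rcases hb' : ψ'.1 b with i | y'
      · exact absurd (h2 _ _ hb') (by simp [hb])
      rw [ha', hb', Sum.Lex.inr_lt_inr_iff] at hab'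
      rw [Sum.Lex.inr_lt_inr_iff] at hab
      refine Sum.Lex.inr_lt_inr_iff.2 ?_
      simp only [Sum.elim_inr, id]
      rcases h0.eq_or_lt with rfl | h0
      · simpa using hab
      · have := mul_lt_mul_of_pos_left hab' h0
        have := mul_le_mul_of_nonneg_left hab.le (sub_nonneg.2 h1')
        linarith
  have hinj : ∀ τ : unitInterval, Function.Injective (G τ) := by
    intro τ a b hab
    by_contra hne
    rcases lt_or_gt_of_ne (fun e => hne (ψ.2 (toLex.injective e))) with h | h
    · exact (hlt τ _ _ h).ne (congrArg toLex hab)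
    · exact (hlt τ _ _ h).ne (congrArg toLex hab.symm)
  refine ⟨⟨⟨fun τ => ⟨G τ, hinj τ⟩, ?_⟩, ?_, ?_⟩⟩
  · refine Continuous.subtype_mk (continuous_pi fun a => ?_) _
    simp only [G]
    rcases ψ.1 a with i | x
    · exact continuous_const
    · exact continuous_inr.comp (by fun_prop)
  · refine Subtype.ext (funext fun a => ?_)
    simp only [G]
    rcases ψ.1 a with i | x <;> simp
  · refine Subtype.ext (funext fun a => ?_)
    simp only [G]
    rcases ha : ψ.1 a with i | x
    · exact (h1 _ _ ha).symm
    · rcases ha' : ψ'.1 a with j | y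
      · exact absurd (h2 _ _ ha') (by simp [ha])
      · simp

/-- The class of a point in `H₀`. -/
def cls (ψ : EmbSpace ℓ S) : RelH0 (EmbSpace ℓ S) (bad ℓ S) :=
  Submodule.Quotient.mk (Finsupp.single ψ 1)

theorem cls_eq_zero {ψ : EmbSpace ℓ S} (h : ψ ∈ bad ℓ S) : cls ψ = 0 :=
  (Submodule.Quotient.mk_eq_zero _).2 (Submodule.subset_span (Or.inr ⟨ψ, h, rfl⟩))

theorem cls_eq_cls {ψ ψ' : EmbSpace ℓ S} (hψ : ψ ∉ bad ℓ S) (hψ' : ψ' ∉ bad ℓ S)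
    {l : List S.carrier} (h : IsWord ψ l) (h' : IsWord ψ' l) : cls ψ = cls ψ' := by
  obtain ⟨γ⟩ := exists_path (ψ := ψ') (ψ' := ψ) (fun _ _ => h'.lt_of_lt h)
    (eq_inl_of_forall_lt hψ' hψ fun _ _ => h'.lt_of_lt h)
    (eq_inl_of_forall_lt hψ hψ' fun _ _ => h.lt_of_lt h')
  exact (Submodule.Quotient.eq _).2 (Submodule.subset_span (Or.inl ⟨_, _, γ, rfl⟩))

open Classical in
/-- A homomorphism out of `H₀` that is given by its values on words. -/
def lift {B : Type*} [AddCommGroup B] (ℓ : ℕ) (S : FI) (y : List S.carrier → B) :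
    RelH0 (EmbSpace ℓ S) (bad ℓ S) →ₗ[ℤ] B :=
  Submodule.liftQ _
    (Finsupp.linearCombination ℤ fun ψ => if ψ ∈ bad ℓ S then 0 else y (word ψ)) <| by
    rw [relBoundaries, Submodule.span_le]
    rintro z (⟨x, x', γ, rfl⟩ | ⟨x, hx, rfl⟩)
    · simp [mem_bad_iff_of_path γ, word_eq_of_path γ]
    · simp [hx]

theorem lift_cls_of_mem {B : Type*} [AddCommGroup B] (y : List S.carrier → B) {ψ : EmbSpace ℓ S}
    (h : ψ ∈ bad ℓ S) : lift ℓ S y (cls ψ) = 0 := by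
  rw [cls_eq_zero h, map_zero]

theorem lift_cls {B : Type*} [AddCommGroup B] (y : List S.carrier → B) {ψ : EmbSpace ℓ S}
    (h : ψ ∉ bad ℓ S) {l : List S.carrier} (hl : IsWord ψ l) : lift ℓ S y (cls ψ) = y l := by
  rw [hl.unique (isWord_word ψ)]
  simp [lift, cls, h]

end EmbSpace

theorem EmbSpace.le_of_notMem_bad {ℓ k : ℕ} {ψ : EmbSpace ℓ (FI.std k)}
    (h : ψ ∉ EmbSpace.bad ℓ (FI.std k)) : ℓ ≤ k := by
  choose a ha using EmbSpace.notMem_bad_iff.1 h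
  have hinj : Function.Injective (β := Fin k) a := fun i j hij =>
    Sum.inl_injective ((ha i).symm.trans ((congrArg ψ.1 hij).trans (ha j)))
  simpa using Fintype.card_le_of_injective _ hinj

theorem EmbSpace.IsWord.length_eq {ℓ k : ℕ} {ψ : EmbSpace ℓ (FI.std k)} {l : List (Fin k)}
    (h : ψ.IsWord l) : l.length = k := by
  have h1 : l.Nodup := h.nodup
  have h2 : ∀ a : Fin k, a ∈ l := h.1
  have h3 : l.toFinset = Finset.univ := Finset.ext fun a => by simpa using h2 a
  rw [← List.toFinset_card_of_nodup h1, h3, Finset.card_fin]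

namespace Filling

/-! The embedding of `[n]` that belongs to a filling -/

/-- The points in the second row go to `[ℓ]`, in reverse order, those in the first row to `ℝ`. -/
def point : ∀ {n} (t : Filling n), Fin n → Fin (deg t) ⊕ ℝ
  | 0, _ => Fin.elim0
  | n + 1, .inl t =>
    Fin.lastCases (motive := fun _ => Fin (deg t) ⊕ ℝ) (Sum.inr (n : ℝ)) (point t)
  | _ + 1, .inr t =>
    Fin.lastCases (motive := fun _ => Fin (deg t + 1) ⊕ ℝ) (Sum.inl 0)
      fun p => (point t p).map Fin.succ id

section

variable {n : ℕ} (t : Filling n) (p : Fin n)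

@[simp] theorem point_inl_last :
    point (n := n + 1) (.inl t) (Fin.last n) = Sum.inr (n : ℝ) := by
  exact Fin.lastCases_last

@[simp] theorem point_inl_castSucc :
    point (n := n + 1) (.inl t) p.castSucc = point t p := by
  exact Fin.lastCases_castSucc _

@[simp] theorem point_inr_last :
    point (n := n + 1) (.inr t) (Fin.last n) = Sum.inl (0 : Fin (deg t + 1)) := by
  exact Fin.lastCases_last

@[simp] theorem point_inr_castSucc :
    point (n := n + 1) (.inr t) p.castSucc = (point t p).map Fin.succ id := by
  exact Fin.lastCases_castSucc _

end

theorem lt_of_point_eq_inr : ∀ {n} (t : Filling n) {p : Fin n} {x : ℝ}, point t p = Sum.inr x →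
    x < n
  | 0, _, p, _, _ => p.elim0
  | n + 1, .inl t, p, x, h => by
    induction p using Fin.lastCases with
    | last =>
      rw [point_inl_last, Sum.inr.injEq] at h
      rw [← h]; push_cast; linarith
    | cast p =>
      rw [point_inl_castSucc] at h
      have := lt_of_point_eq_inr t h
      push_cast; linarith
  | n + 1, .inr t, p, x, h => by
    induction p using Fin.lastCases with
    | last =>
      rw [point_inr_last] at h
      exact absurd h (by simp)
    | cast p =>
      rw [point_inr_castSucc] at h
      rcases hp : point t p with j | y
      · simp [hp] at h
      · rw [hp] at h
        obtain rfl : y = x := Sum.inr.inj h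
        have := lt_of_point_eq_inr t hp
        push_cast; linarith

theorem toLex_point_inl_lt {n : ℕ} (t : Filling n) (p : Fin n) :
    toLex (point (n := n + 1) (.inl t) p.castSucc) <
      toLex (point (n := n + 1) (.inl t) (Fin.last n)) := by
  rw [point_inl_castSucc, point_inl_last]
  rcases hp : point t p with j | x
  · exact Sum.Lex.inl_lt_inr _ _
  · exact Sum.Lex.inr_lt_inr_iff.2 (lt_of_point_eq_inr t hp)

theorem toLex_point_inr_lt {n : ℕ} (t : Filling n) (p : Fin n) :
    toLex (point (n := n + 1) (.inr t) (Fin.last n)) <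
      toLex (point (n := n + 1) (.inr t) p.castSucc) := by
  rw [point_inr_castSucc, point_inr_last]
  rcases point t p with j | x
  · exact Sum.Lex.inl_lt_inl_iff.2 (Fin.succ_pos j)
  · exact Sum.Lex.inl_lt_inr _ _

theorem toLex_point_inr_castSucc_lt {n : ℕ} (t : Filling n) {p q : Fin n}
    (h : toLex (point t p) < toLex (point t q)) :
    toLex (point (n := n + 1) (.inr t) p.castSucc) <
      toLex (point (n := n + 1) (.inr t) q.castSucc) := by
  rw [point_inr_castSucc, point_inr_castSucc]
  rcases hp : point t p with i | x <;> rcases hq : point t q with j | y <;> rw [hp, hq] at h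
  · exact Sum.Lex.inl_lt_inl_iff.2 (Fin.succ_lt_succ_iff.2 (Sum.Lex.inl_lt_inl_iff.1 h))
  · exact Sum.Lex.inl_lt_inr _ _
  · exact absurd h Sum.Lex.not_inr_lt_inl
  · exact Sum.Lex.inr_lt_inr_iff.2 (Sum.Lex.inr_lt_inr_iff.1 h)

theorem injective_point : ∀ {n} (t : Filling n), Function.Injective (point t)
  | 0, _ => fun p => p.elim0
  | n + 1, .inl t => by
    intro p q h
    induction p using Fin.lastCases with
    | last =>
      induction q using Fin.lastCases with
      | last => rfl
      | cast q => exact absurd (congrArg toLex h.symm) (toLex_point_inl_lt t q).ne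
    | cast p =>
      induction q using Fin.lastCases with
      | last => exact absurd (congrArg toLex h) (toLex_point_inl_lt t p).ne
      | cast q =>
        rw [point_inl_castSucc, point_inl_castSucc] at h
        rw [injective_point t h]
  | n + 1, .inr t => by
    intro p q h
    induction p using Fin.lastCases with
    | last =>
      induction q using Fin.lastCases with
      | last => rfl
      | cast q => exact absurd (congrArg toLex h) (toLex_point_inr_lt t q).ne
    | cast p =>
      induction q using Fin.lastCases with
      | last => exact absurd (congrArg toLex h.symm) (toLex_point_inr_lt t p).ne
      | cast q =>
        rw [point_inr_castSucc, point_inr_castSucc] at h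
        rw [injective_point t (Function.Injective.sumMap (Fin.succ_injective _)
          Function.injective_id h)]

/-! ### Words of a filling and the order of its points -/

variable {α : Type*}

theorem mem_of_word_eq_some : ∀ {n} (t : Filling n) {v : Fin n → Option α} {l : List α},
    word t v = some l → ∀ a, a ∈ l ↔ ∃ p, v p = some a
  | 0, _, _, l, h, a => by
    obtain rfl : [] = l := Option.some.inj h
    simp
  | n + 1, .inl t, v, l, h, a => by
    rw [Fin.exists_fin_succ', word] at *
    rcases hv : v (Fin.last n) with - | s <;>
      simp only [hv, Option.elim_none, Option.elim_some, Option.map_eq_some_iff] at h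
    · have := mem_of_word_eq_some t h a
      simp_all
    · obtain ⟨l, h, rfl⟩ := h
      have := mem_of_word_eq_some t h a
      simp_all [eq_comm]
  | n + 1, .inr t, v, l, h, a => by
    rw [Fin.exists_fin_succ', word] at *
    rcases hv : v (Fin.last n) with - | s <;>
      simp only [hv, Option.elim_none, Option.elim_some, Option.map_eq_some_iff] at h
    · simp at h
    · obtain ⟨l, h, rfl⟩ := h
      have := mem_of_word_eq_some t h a
      simp_all [eq_comm, or_comm]

theorem pairwise_of_word_eq_some : ∀ {n} (t : Filling n) {v : Fin n → Option α} {l : List α},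
    word t v = some l → l.Pairwise fun a b =>
      ∃ p q, v p = some a ∧ v q = some b ∧ toLex (point t p) < toLex (point t q)
  | 0, _, _, l, h => by
    obtain rfl : [] = l := Option.some.inj h
    simp
  | n + 1, .inl t, v, l, h => by
    rw [word] at h
    have key : ∀ l : List α, word t (v ∘ Fin.castSucc) = some l → l.Pairwise fun a b =>
        ∃ p q, v p = some a ∧ v q = some b ∧ toLex (point (n := n + 1) (.inl t) p) <
          toLex (point (n := n + 1) (.inl t) q) := fun l h =>
      (pairwise_of_word_eq_some t h).imp fun ⟨p, q, hp, hq, hpq⟩ =>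
        ⟨p.castSucc, q.castSucc, hp, hq, by rwa [point_inl_castSucc, point_inl_castSucc]⟩
    rcases hv : v (Fin.last n) with - | s <;>
      simp only [hv, Option.elim_none, Option.elim_some, Option.map_eq_some_iff] at h
    · exact key l h
    · obtain ⟨l, h, rfl⟩ := h
      refine List.pairwise_append.2 ⟨key l h, List.pairwise_singleton _ _, fun a ha b hb => ?_⟩
      obtain rfl := List.mem_singleton.1 hb
      obtain ⟨p, hp⟩ := (mem_of_word_eq_some t h a).1 ha
      exact ⟨p.castSucc, Fin.last n, hp, hv, toLex_point_inl_lt t p⟩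
  | n + 1, .inr t, v, l, h => by
    rw [word] at h
    rcases hv : v (Fin.last n) with - | s <;>
      simp only [hv, Option.elim_none, Option.elim_some, Option.map_eq_some_iff] at h
    · simp at h
    · obtain ⟨l, h, rfl⟩ := h
      refine List.pairwise_cons.2 ⟨fun b hb => ?_, (pairwise_of_word_eq_some t h).imp
        fun ⟨p, q, hp, hq, hpq⟩ =>
          ⟨p.castSucc, q.castSucc, hp, hq, toLex_point_inr_castSucc_lt t hpq⟩⟩
      obtain ⟨p, hp⟩ := (mem_of_word_eq_some t h b).1 hb
      exact ⟨Fin.last n, p.castSucc, hv, hp, toLex_point_inr_lt t p⟩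

/-- With `exists_of_word_eq_none`: a word is defined exactly if the labelled points still cover
`[ℓ]`, which separates embeddings outside the bad set from those inside. -/
theorem exists_of_word_eq_some : ∀ {n} (t : Filling n) {v : Fin n → Option α} {l : List α},
    word t v = some l → ∀ j, ∃ p a, v p = some a ∧ point t p = Sum.inl j
  | 0, _, _, _, _, j => j.elim0
  | n + 1, .inl t, v, l, h, j => by
    rw [word] at h
    have key : ∀ l : List α, word t (v ∘ Fin.castSucc) = some l →
        ∃ p a, v p = some a ∧ point (n := n + 1) (.inl t) p = Sum.inl j := fun l h => by
      obtain ⟨p, a, hp, hj⟩ := exists_of_word_eq_some t h j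
      exact ⟨p.castSucc, a, hp, by rwa [point_inl_castSucc]⟩
    rcases hv : v (Fin.last n) with - | s <;>
      simp only [hv, Option.elim_none, Option.elim_some, Option.map_eq_some_iff] at h
    · exact key l h
    · obtain ⟨l, h, rfl⟩ := h
      exact key l h
  | n + 1, .inr t, v, l, h, j => by
    rw [word] at h
    rcases hv : v (Fin.last n) with - | s <;>
      simp only [hv, Option.elim_none, Option.elim_some, Option.map_eq_some_iff] at h
    · simp at h
    · obtain ⟨l, h, rfl⟩ := h
      change Fin (deg t + 1) at j
      induction j using Fin.cases with
      | zero => exact ⟨Fin.last n, s, hv, point_inr_last t⟩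
      | succ j =>
        obtain ⟨p, a, hp, hj⟩ := exists_of_word_eq_some t h j
        exact ⟨p.castSucc, a, hp, by rw [point_inr_castSucc, hj]; rfl⟩

theorem exists_of_word_eq_none : ∀ {n} (t : Filling n) {v : Fin n → Option α},
    word t v = none → ∃ p j, v p = none ∧ point t p = Sum.inl j
  | 0, _, _, h => absurd h (Option.some_ne_none _)
  | n + 1, .inl t, v, h => by
    rw [word] at h
    have h' : word t (v ∘ Fin.castSucc) = none := by
      rcases hv : v (Fin.last n) with - | s <;> simpa [hv] using h
    obtain ⟨p, j, hp, hj⟩ := exists_of_word_eq_none t h'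
    exact ⟨p.castSucc, j, hp, by rwa [point_inl_castSucc]⟩
  | n + 1, .inr t, v, h => by
    rw [word] at h
    rcases hv : v (Fin.last n) with - | s
    · exact ⟨Fin.last n, _, hv, point_inr_last t⟩
    · have h' : word t (v ∘ Fin.castSucc) = none := by simpa [hv] using h
      obtain ⟨p, j, hp, hj⟩ := exists_of_word_eq_none t h'
      exact ⟨p.castSucc, j.succ, hp, by rw [point_inr_castSucc, hj]; rfl⟩

/-- The embedding that belongs to a filling, as a point of the space of embeddings. -/
def emb {n : ℕ} (t : Filling n) : EmbSpace (deg t) (FI.std n) := ⟨point t, injective_point t⟩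

section Restriction

variable {k n : ℕ} (f : FI.std k ⟶ FI.std n)

/-- The labelling of the image of an injection by the preimages. -/
def labelling : Fin n → Option (Fin k) := Function.partialInv (FI.toFun f)

variable {f}

theorem labelling_eq_some {p : Fin n} {i : Fin k} :
    labelling f p = some i ↔ FI.toFun f i = p :=
  (FI.toFun_injective f).isPartialInv i p

theorem size_eq_card {α : Type*} (v : Fin n → Option α) :
    size v = Nat.card {p // (v p).isSome} := by
  rw [size, Finset.sum_boole, Nat.card_eq_fintype_card, Fintype.card_subtype, Nat.cast_id]

variable (f) in
theorem size_labelling : size (labelling f) = k := by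
  have e : Fin k ≃ {p // (labelling f p).isSome} :=
    Equiv.ofBijective (fun i => ⟨FI.toFun f i, by rw [labelling_eq_some.2 rfl]; rfl⟩)
      ⟨fun i j h => FI.toFun_injective f (congrArg Subtype.val h), fun ⟨p, hp⟩ => by
        obtain ⟨i, hi⟩ := Option.isSome_iff_exists.1 hp
        exact ⟨i, Subtype.ext (labelling_eq_some.1 hi)⟩⟩
  rw [size_eq_card, ← Nat.card_congr e, Nat.card_fin]

/-- If all `k` labels occur among `k` labelled points, none is repeated. -/
theorem exists_labelling_eq {v : Fin n → Option (Fin k)} (hv : size v = k)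
    (h : ∀ a, ∃ p, v p = some a) : ∃ f : FI.std k ⟶ FI.std n, labelling f = v := by
  choose f hf using h
  have hinj : Function.Injective f := fun a b hab => Option.some.inj (by rw [← hf a, hab, hf b])
  refine ⟨(⟨f, hinj⟩ : Fin k ↪ Fin n), ?_⟩
  have hb : Function.Bijective
      (fun a : Fin k => (⟨f a, by rw [hf a]; rfl⟩ : {p // (v p).isSome})) := by
    rw [Fintype.bijective_iff_injective_and_card]
    refine ⟨fun a b hab => hinj (congrArg Subtype.val hab), ?_⟩
    rw [Fintype.card_fin, ← Nat.card_eq_fintype_card, ← size_eq_card, hv]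
  funext p
  refine Option.ext fun a => labelling_eq_some.trans ?_
  constructor
  · rintro rfl
    exact hf a
  · intro hp
    obtain ⟨b, hb⟩ := hb.2 ⟨p, by rw [hp]; rfl⟩
    obtain rfl : f b = p := congrArg Subtype.val hb
    obtain rfl : b = a := Option.some.inj (by rw [← hf b, hp])
    rfl

theorem isWord_of_word_labelling {t : Filling n} {l : List (Fin k)}
    (h : word t (labelling f) = some l) :
    EmbSpace.precomp (deg t) f (emb t) ∉ EmbSpace.bad (deg t) (FI.std k) ∧
      EmbSpace.IsWord (EmbSpace.precomp (deg t) f (emb t)) l := by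
  refine ⟨EmbSpace.notMem_bad_iff.2 fun j => ?_, fun a => ?_, ?_⟩
  · obtain ⟨p, a, hp, hj⟩ := exists_of_word_eq_some t h j
    obtain rfl := labelling_eq_some.1 hp
    exact ⟨a, hj⟩
  · exact (mem_of_word_eq_some t h a).2 ⟨_, labelling_eq_some.2 rfl⟩
  · refine (pairwise_of_word_eq_some t h).imp ?_
    rintro a b ⟨p, q, hp, hq, hpq⟩
    obtain rfl := labelling_eq_some.1 hp
    obtain rfl := labelling_eq_some.1 hq
    exact hpq

theorem mem_bad_of_word_labelling {t : Filling n} (h : word t (labelling f) = none) :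
    EmbSpace.precomp (deg t) f (emb t) ∈ EmbSpace.bad (deg t) (FI.std k) := by
  obtain ⟨p, j, hp, hj⟩ := exists_of_word_eq_none t h
  by_contra hb
  obtain ⟨a, ha⟩ := EmbSpace.notMem_bad_iff.1 hb j
  have : FI.toFun f a = p := injective_point t (ha.trans hj.symm)
  rw [labelling_eq_some.2 this] at hp
  exact absurd hp (by simp)

/-- The bridge from homology to combinatorics: one term of `pairing` is the value of a homomorphism
on a restricted tableau class. -/
theorem lift_cls_precomp {B : Type*} [AddCommGroup B] (t : Filling n) (y : List (Fin k) → B) :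
    EmbSpace.lift (deg t) (FI.std k) y (EmbSpace.cls (EmbSpace.precomp (deg t) f (emb t))) =
      (word t (labelling f)).elim 0 y := by
  rcases h : word t (labelling f) with - | l
  · exact EmbSpace.lift_cls_of_mem _ (mem_bad_of_word_labelling h)
  · exact EmbSpace.lift_cls _ (isWord_of_word_labelling h).1 (isWord_of_word_labelling h).2

end Restriction

end Filling

/-! Representable modules in low degrees -/

/-- Extending the identity of `P` gives a retraction; the projection to the cokernel vanishes on the
range, so the cokernel is zero. -/
theorem LinearMap.bijective_of_forall_exists_comp_eq {P G : Type v} [AddCommGroup P]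
    [AddCommGroup G] (Φ : P →ₗ[ℤ] G)
    (h1 : ∀ (B : Type v) [AddCommGroup B] (ψ : P →ₗ[ℤ] B), ∃ Ψ : G →ₗ[ℤ] B, Ψ ∘ₗ Φ = ψ)
    (h2 : ∀ (B : Type v) [AddCommGroup B] (Ψ : G →ₗ[ℤ] B), Ψ ∘ₗ Φ = 0 → Ψ = 0) :
    Function.Bijective Φ := by
  constructor
  · obtain ⟨Ψ, hΨ⟩ := h1 P LinearMap.id
    exact Function.LeftInverse.injective (LinearMap.congr_fun hΨ)
  · rw [← LinearMap.range_eq_top, ← Submodule.ker_mkQ (LinearMap.range Φ),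
      h2 _ (LinearMap.range Φ).mkQ (LinearMap.range_mkQ_comp Φ), LinearMap.ker_zero]

/-- The standard Young tableaux with `n` entries and second row of length at most `d`. -/
abbrev Tableau (n d : ℕ) : Type := {t : Filling n // t.IsBallot ∧ t.deg ≤ d}

instance (n d : ℕ) : Fintype (Tableau n d) := Fintype.ofInjective Subtype.val Subtype.val_injective

/-- The class of the embedding that belongs to a tableau. -/
def Tableau.xi {n d : ℕ} (t : Tableau n d) : (Xi t.1.deg).obj (Opposite.op (FI.std n)) :=
  EmbSpace.cls t.1.emb

/-- The natural map from the representable module `ℤ FI(-, T)` to a product, given by elements of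
degree `T`. -/
def yonedaPi {ι : Type} (N : ι → FIᵒᵖ ⥤ ModuleCat.{0} ℤ) {T : FI}
    (w : ∀ t, (N t).obj (Opposite.op T)) (S : FI) :
    ((S ⟶ T) →₀ ℤ) →ₗ[ℤ] ∀ t, (N t).obj (Opposite.op S) :=
  Finsupp.linearCombination ℤ fun f t => ((N t).map f.op).hom (w t)

theorem bijective_yonedaPi_xi {n d k : ℕ} (hn : 2 * d ≤ n + 1) (hk : k ≤ d) :
    Function.Bijective (yonedaPi (fun t : Tableau n d => Xi t.1.deg) Tableau.xi (FI.std k)) := by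
  classical
  have hxi : ∀ (f : FI.std k ⟶ FI.std n) (t : Tableau n d),
      ((Xi t.1.deg).map f.op).hom t.xi = EmbSpace.cls (EmbSpace.precomp t.1.deg f t.1.emb) :=
    fun f t => RelH0.map_mk_single _ (EmbSpace.continuous_precomp _ f)
      (EmbSpace.mapsTo_precomp _ f) _
  have hsum : ∀ {B : Type} [AddCommGroup B] (F : Filling n → B),
      (∀ t, ¬ (t.IsBallot ∧ t.deg ≤ d) → F t = 0) → ∑ t : Tableau n d, F t.1 = ∑ t, F t := by
    intro B _ F hF
    rw [← Finset.sum_filter_of_ne (p := fun t => t.IsBallot ∧ t.deg ≤ d)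
      fun t _ ht => by_contra fun h => ht (hF t h)]
    exact (Finset.sum_subtype _ (by simp) F).symm
  refine LinearMap.bijective_of_forall_exists_comp_eq _ (fun B _ ψ => ?_) (fun B _ Ψ hΨ => ?_)
  -- Labellings with repeated labels do not come from injections; the value `0` there is an
  -- arbitrary choice.
  · obtain ⟨y, hy, hy'⟩ := Filling.exists_pairing_eq n k fun v : Fin n → Option (Fin k) =>
      if h : ∃ f : FI.std k ⟶ FI.std n, Filling.labelling f = v then
        ψ (Finsupp.single (Classical.choose h) 1) else 0
    refine ⟨∑ t : Tableau n d, EmbSpace.lift t.1.deg (FI.std k) (y t.1) ∘ₗ LinearMap.proj t, ?_⟩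
    refine Finsupp.lhom_ext' fun f => LinearMap.ext_ring ?_
    have h : ∃ f' : FI.std k ⟶ FI.std n, Filling.labelling f' = Filling.labelling f := ⟨f, rfl⟩
    have hf : Classical.choose h = f := by
      have := Classical.choose_spec h
      refine DFunLike.ext (F := Fin k ↪ Fin n) _ _ fun i => ?_
      exact Filling.labelling_eq_some.1 (by rw [this]; exact Filling.labelling_eq_some.2 rfl)
    have key := hy' (Filling.labelling f) (Filling.size_labelling f)
    rw [dif_pos h, hf] at key
    simp only [LinearMap.comp_apply, Finsupp.lsingle_apply, LinearMap.sum_apply, yonedaPi,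
      Finsupp.linearCombination_single, one_smul]
    rw [← key, Filling.pairing, ← hsum]
    · refine Finset.sum_congr rfl fun t _ => ?_
      exact (congrArg _ (hxi f t)).trans (Filling.lift_cls_precomp t.1 (y t.1))
    · intro t ht
      rcases Filling.word t (Filling.labelling f) with - | l
      · rfl
      · exact hy t l fun h' => ht ⟨h'.1, h'.2.1.trans hk⟩
  -- The function on words that `Ψ` induces on each factor; by `EmbSpace.cls_eq_cls` the chosen
  -- embedding does not matter.
  · let y : Filling n → List (Fin k) → B := fun t l =>
      if h : (t.IsBallot ∧ t.deg ≤ d) ∧ ∃ ψ : EmbSpace t.deg (FI.std k),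
          ψ ∉ EmbSpace.bad t.deg (FI.std k) ∧ ψ.IsWord l then
        Ψ (Pi.single (M := fun t : Tableau n d => (Xi t.1.deg).obj (Opposite.op (FI.std k)))
          ⟨t, h.1⟩ (EmbSpace.cls (Classical.choose h.2))) else 0
    have hy : ∀ (t : Tableau n d) (ψ : EmbSpace t.1.deg (FI.std k)) (l : List (Fin k)),
        ψ ∉ EmbSpace.bad t.1.deg (FI.std k) → ψ.IsWord l →
        y t.1 l = Ψ (Pi.single (M := fun t : Tableau n d => (Xi t.1.deg).obj
          (Opposite.op (FI.std k))) t (EmbSpace.cls ψ)) := by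
      intro t ψ l hψ hl
      have h : (t.1.IsBallot ∧ t.1.deg ≤ d) ∧ ∃ ψ : EmbSpace t.1.deg (FI.std k),
          ψ ∉ EmbSpace.bad t.1.deg (FI.std k) ∧ ψ.IsWord l := ⟨t.2, ψ, hψ, hl⟩
      have h' := Classical.choose_spec h.2
      simp only [y, dif_pos h]
      rw [EmbSpace.cls_eq_cls h'.1 hψ h'.2 hl]
    have hy0 : ∀ t l, y t l = 0 := by
      refine Filling.eq_zero_of_pairing_eq_zero n k y ?_ ?_ ?_
      · refine fun t l ht => dif_neg ?_
        rintro ⟨⟨h1, h2⟩, ψ, hψ, -⟩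
        refine ht ⟨h1, ?_, ?_⟩
        · exact EmbSpace.le_of_notMem_bad hψ
        -- Here `n ≥ 2d - 1` enters: `deg t + k ≤ n` is the ballot condition if `deg t = k`, and
        -- follows from `2k ≤ 2d ≤ n + 1` if `deg t < k`.
        · have := h1.two_mul_deg_le
          have := EmbSpace.le_of_notMem_bad hψ
          omega
      · refine fun t l hl => dif_neg ?_
        rintro ⟨-, ψ, -, hψ⟩
        exact hl hψ.length_eq
      · intro v hv
        by_cases h : ∃ f : FI.std k ⟶ FI.std n, Filling.labelling f = v
        · obtain ⟨f, rfl⟩ := h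
          rw [Filling.pairing, ← hsum]
          · have := LinearMap.congr_fun hΨ (Finsupp.single f 1)
            simp only [LinearMap.comp_apply, yonedaPi, Finsupp.linearCombination_single, one_smul,
              LinearMap.zero_apply] at this
            rw [← Finset.univ_sum_single fun t : Tableau n d =>
              ((Xi t.1.deg).map f.op).hom t.xi, map_sum] at this
            refine (Finset.sum_congr rfl fun t _ => ?_).trans this
            rcases hl : Filling.word t.1 (Filling.labelling f) with - | l
            · have h0 : ((Xi t.1.deg).map f.op).hom t.xi = 0 :=
                (hxi f t).trans (EmbSpace.cls_eq_zero (Filling.mem_bad_of_word_labelling hl))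
              rw [h0, Pi.single_zero, map_zero, Option.elim_none]
            · have h0 := Filling.isWord_of_word_labelling hl
              exact (hy t _ l h0.1 h0.2).trans (congrArg _ (congrArg _ (hxi f t).symm))
          · intro t ht
            rcases Filling.word t (Filling.labelling f) with - | l
            · rfl
            · exact dif_neg fun h' => ht h'.1
        -- Such a labelling misses a label, so its words are not orderings of `[k]`.
        · refine Finset.sum_eq_zero fun t _ => ?_
          rcases hl : Filling.word t v with - | l
          · rfl
          · refine dif_neg ?_
            rintro ⟨-, ψ, -, hψ⟩
            exact h (Filling.exists_labelling_eq hv fun a =>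
              (Filling.mem_of_word_eq_some t hl a).1 (hψ.1 a))
    refine LinearMap.pi_ext' fun t => RelH0.hom_ext fun ψ => ?_
    change Ψ (Pi.single (M := fun t : Tableau n d => (Xi t.1.deg).obj
      (Opposite.op (FI.std k))) t (EmbSpace.cls ψ)) = 0
    by_cases hψ : ψ ∈ EmbSpace.bad t.1.deg (FI.std k)
    · rw [EmbSpace.cls_eq_zero hψ]
      exact (congrArg Ψ (Pi.single_zero t)).trans (map_zero Ψ)
    · exact (hy t ψ _ hψ ψ.isWord_word).symm.trans (hy0 _ _)

/-! The functor tensor product -/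

section Tensor

variable {R : Type u} [CommRing R] {M : FI ⥤ ModuleCat.{v} R}

namespace TensorFI

variable {N : FIᵒᵖ ⥤ ModuleCat.{0} ℤ}

theorem _root_.TensorSum.add_tmul (k : ℕ) (m m' : M.obj (FI.std k))
    (ξ : N.obj (Opposite.op (FI.std k))) : TensorSum.tmul M N k (m + m') ξ =
      TensorSum.tmul M N k m ξ + TensorSum.tmul M N k m' ξ := by
  rw [TensorSum.tmul, TensorProduct.add_tmul, map_add]
  rfl

theorem _root_.TensorSum.tmul_add (k : ℕ) (m : M.obj (FI.std k))
    (ξ ξ' : N.obj (Opposite.op (FI.std k))) : TensorSum.tmul M N k m (ξ + ξ') =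
      TensorSum.tmul M N k m ξ + TensorSum.tmul M N k m ξ' := by
  rw [TensorSum.tmul, TensorProduct.tmul_add, map_add]
  rfl

theorem _root_.TensorSum.smul_tmul (k : ℕ) (c : R) (m : M.obj (FI.std k))
    (ξ : N.obj (Opposite.op (FI.std k))) :
    TensorSum.tmul M N k (c • m) ξ = c • TensorSum.tmul M N k m ξ := by
  rw [TensorSum.tmul, ← TensorProduct.smul_tmul', map_smul]
  rfl

variable (M N) in
/-- The class of `m ⊗ ξ`, as a bilinear map. -/
def mk (k : ℕ) : M.obj (FI.std k) →ₗ[R] N.obj (Opposite.op (FI.std k)) →ₗ[ℤ] TensorFI M N :=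
  LinearMap.mk₂' R ℤ (fun m ξ => Submodule.Quotient.mk (TensorSum.tmul M N k m ξ))
    (fun m m' ξ => congrArg Submodule.Quotient.mk (TensorSum.add_tmul k m m' ξ))
    (fun c m ξ => congrArg Submodule.Quotient.mk (TensorSum.smul_tmul k c m ξ))
    (fun m ξ ξ' => congrArg Submodule.Quotient.mk (TensorSum.tmul_add k m ξ ξ'))
    (fun c m ξ => map_intCast_smul (AddMonoidHom.mk' (fun ξ => (Submodule.Quotient.mk
      (TensorSum.tmul M N k m ξ) : TensorFI M N))
      fun ξ ξ' => congrArg Submodule.Quotient.mk (TensorSum.tmul_add k m ξ ξ')) ℤ ℤ c ξ)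

theorem mk_map {p q : ℕ} (f : FI.std p ⟶ FI.std q) (m : M.obj (FI.std p))
    (ξ : N.obj (Opposite.op (FI.std q))) :
    mk M N q ((M.map f).hom m) ξ = mk M N p m ((N.map f.op).hom ξ) :=
  (Submodule.Quotient.eq _).2 (Submodule.subset_span ⟨p, q, f, m, ξ, rfl⟩)

theorem exists_lift {P : Type*} [AddCommGroup P] [Module R P]
    (B : ∀ k, M.obj (FI.std k) →ₗ[R] N.obj (Opposite.op (FI.std k)) →ₗ[ℤ] P)
    (hB : ∀ (p q : ℕ) (f : FI.std p ⟶ FI.std q) (m : M.obj (FI.std p))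
      (ξ : N.obj (Opposite.op (FI.std q))), B q ((M.map f).hom m) ξ = B p m ((N.map f.op).hom ξ)) :
    ∃ θ : TensorFI M N →ₗ[R] P, ∀ k m ξ, θ (mk M N k m ξ) = B k m ξ := by
  let θ₀ : TensorSum M N →ₗ[R] P :=
    DirectSum.toModule R ℕ P fun k => TensorProduct.AlgebraTensorModule.lift (B k)
  have hθ₀ : ∀ k m ξ, θ₀ (TensorSum.tmul M N k m ξ) = B k m ξ := fun k m ξ => by
    simp [θ₀, TensorSum.tmul]
  refine ⟨Submodule.liftQ _ θ₀ ?_, hθ₀⟩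
  rw [Submodule.span_le]
  rintro _ ⟨p, q, f, m, ξ, rfl⟩
  rw [SetLike.mem_coe, LinearMap.mem_ker, map_sub, hθ₀, hθ₀, hB, sub_self]

theorem hom_ext {P : Type*} [AddCommMonoid P] [Module R P] {θ θ' : TensorFI M N →ₗ[R] P}
    (h : ∀ k m ξ, θ (mk M N k m ξ) = θ' (mk M N k m ξ)) : θ = θ' := by
  let := Module.addCommMonoidToAddCommGroup R (M := P)
  suffices θ ∘ₗ Submodule.mkQ _ = θ' ∘ₗ Submodule.mkQ _ by
    refine LinearMap.ext fun z => ?_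
    obtain ⟨y, rfl⟩ := Submodule.mkQ_surjective _ z
    exact LinearMap.congr_fun this y
  refine DirectSum.linearMap_ext R fun k => TensorProduct.AlgebraTensorModule.ext fun m ξ => ?_
  exact h k m ξ

end TensorFI

/-- The action of formal linear combinations of injections. -/
def FI.act (M : FI ⥤ ModuleCat.{v} R) (S T : FI) :
    ((S ⟶ T) →₀ ℤ) →ₗ[ℤ] (M.obj S →ₗ[R] M.obj T) :=
  Finsupp.linearCombination ℤ fun f => (M.map f).hom

theorem FI.act_single (M : FI ⥤ ModuleCat.{v} R) {S T : FI} (f : S ⟶ T) :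
    FI.act M S T (Finsupp.single f 1) = (M.map f).hom := by
  simp [FI.act]

theorem FI.act_precomp (M : FI ⥤ ModuleCat.{v} R) {S S' T : FI} (h : S ⟶ S')
    (x : (S' ⟶ T) →₀ ℤ) (m : M.obj S) :
    FI.act M S T (Finsupp.lmapDomain ℤ ℤ (h ≫ ·) x) m = FI.act M S' T x ((M.map h).hom m) := by
  induction x using Finsupp.induction_linear with
  | zero => simp
  | add x y hx hy => simp only [map_add, LinearMap.add_apply, hx, hy]
  | single f c =>
    simp [FI.act]

theorem yonedaPi_precomp {ι : Type} (N : ι → FIᵒᵖ ⥤ ModuleCat.{0} ℤ) {S S' T : FI}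
    (w : ∀ t, (N t).obj (Opposite.op T)) (h : S ⟶ S') (x : (S' ⟶ T) →₀ ℤ) (t : ι) :
    yonedaPi N w S (Finsupp.lmapDomain ℤ ℤ (h ≫ ·) x) t =
      ((N t).map h.op).hom (yonedaPi N w S' x t) := by
  induction x using Finsupp.induction_linear with
  | zero => simp
  | add x y hx hy => simp only [map_add, Pi.add_apply, hx, hy]
  | single f c =>
    simp [yonedaPi]

theorem FreeFI.desc_single (M : FI ⥤ ModuleCat.{v} R) {I : Type v} (a : I → ℕ)
    (g : ∀ i, M.obj (FI.std (a i))) {S : FI} (i : I) (f : FI.std (a i) ⟶ S) :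
    FreeFI.desc M a g S (Finsupp.single ⟨i, f⟩ 1) = (M.map f).hom (g i) := by
  simp [FreeFI.desc]

theorem FreeFI.map_single {I : Type v} (a : I → ℕ) {S T : FI} (h : S ⟶ T) (i : I)
    (f : FI.std (a i) ⟶ S) :
    FreeFI.map R a h (Finsupp.single ⟨i, f⟩ 1) = Finsupp.single ⟨i, f ≫ h⟩ 1 := by
  simp [FreeFI.map]

theorem FreeFI.hom_ext {I : Type v} {a : I → ℕ} {S : FI} {P : Type*} [AddCommGroup P] [Module R P]
    {F G : FreeFI R a S →ₗ[R] P}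
    (h : ∀ i f, F (Finsupp.single ⟨i, f⟩ 1) = G (Finsupp.single ⟨i, f⟩ 1)) : F = G :=
  Finsupp.lhom_ext' fun p => LinearMap.ext_ring (h p.1 p.2)

theorem FreeFI.desc_map (M : FI ⥤ ModuleCat.{v} R) {I : Type v} (a : I → ℕ)
    (g : ∀ i, M.obj (FI.std (a i))) {S T : FI} (h : S ⟶ T) (y : FreeFI R a S) :
    FreeFI.desc M a g T (FreeFI.map R a h y) = (M.map h).hom (FreeFI.desc M a g S y) := by
  suffices FreeFI.desc M a g T ∘ₗ FreeFI.map R a h = (M.map h).hom ∘ₗ FreeFI.desc M a g S from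
    LinearMap.congr_fun this y
  refine FreeFI.hom_ext fun i f => ?_
  rw [LinearMap.comp_apply, LinearMap.comp_apply, FreeFI.map_single, FreeFI.desc_single,
    FreeFI.desc_single]
  simp

/-! ### Comparison of `M_n` with tensor products -/

variable {ι : Type} (N : ι → FIᵒᵖ ⥤ ModuleCat.{0} ℤ) {n : ℕ}
  (w : ∀ t, (N t).obj (Opposite.op (FI.std n)))

variable (M) in
/-- The natural map `m ↦ (m ⊗ w t)` from `M_n` to a product of tensor products. -/
def toTensorPi : M.obj (FI.std n) →ₗ[R] ∀ t, TensorFI M (N t) :=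
  LinearMap.pi fun t => (TensorFI.mk M (N t) n).flip (w t)

theorem toTensorPi_act {k : ℕ} (x : (FI.std k ⟶ FI.std n) →₀ ℤ) (m : M.obj (FI.std k)) (t : ι) :
    toTensorPi M N w (FI.act M _ _ x m) t = TensorFI.mk M (N t) k m (yonedaPi N w _ x t) := by
  induction x using Finsupp.induction_linear with
  | zero => simp
  | add x y hx hy => simp only [map_add, LinearMap.add_apply, Pi.add_apply, hx, hy]
  | single f c =>
    simp [yonedaPi, FI.act, toTensorPi, TensorFI.mk_map]

/-- The pullback of a family of elements along an injection. -/
def pullPi {S T : FI} (f : S ⟶ T) :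
    (∀ t, (N t).obj (Opposite.op T)) →+ ∀ t, (N t).obj (Opposite.op S) where
  toFun ξ t := ((N t).map f.op).hom (ξ t)
  map_zero' := funext fun _ => map_zero _
  map_add' _ _ := funext fun _ => map_add _ _ _

theorem pullPi_comp {S T U : FI} (f : S ⟶ T) (g : T ⟶ U) (ξ : ∀ t, (N t).obj (Opposite.op U)) :
    pullPi N (f ≫ g) ξ = pullPi N f (pullPi N g ξ) := by
  funext t
  simp [pullPi]

/-- In degrees `k ≤ d`, a family `ξ` is a formal combination of injections `[k] → [n]` and so acts
as a map `M_k → M_n`. The presentation extends this action to all `k`; it will provide the inverse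
of `toTensorPi`. -/
theorem exists_hom_of_bijective_yonedaPi {d : ℕ} (hM : IsPresentedInDegreesLE M d)
    (hN : ∀ k ≤ d, Function.Bijective (yonedaPi N w (FI.std k))) :
    ∃ E : ∀ k, (∀ t, (N t).obj (Opposite.op (FI.std k))) →+
        (M.obj (FI.std k) →ₗ[R] M.obj (FI.std n)),
      (∀ (p q : ℕ) (f : FI.std p ⟶ FI.std q) (m : M.obj (FI.std p)) ξ,
        E q ξ ((M.map f).hom m) = E p (pullPi N f ξ) m) ∧
      (∀ k ξ m t, toTensorPi M N w (E k ξ m) t = TensorFI.mk M (N t) k m (ξ t)) ∧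
      ∀ m, E n w m = m := by
  obtain ⟨I, a, g, J, b, r, ha, hb, hsurj, hker⟩ := hM
  let Ψ : ∀ k ≤ d, (∀ t, (N t).obj (Opposite.op (FI.std k))) ≃ₗ[ℤ]
      ((FI.std k ⟶ FI.std n) →₀ ℤ) := fun k hk => (LinearEquiv.ofBijective _ (hN k hk)).symm
  have hΨ : ∀ k hk ξ, yonedaPi N w (FI.std k) (Ψ k hk ξ) = ξ := fun k hk =>
    (LinearEquiv.ofBijective _ (hN k hk)).apply_symm_apply
  have hΨ' : ∀ k hk x, Ψ k hk (yonedaPi N w (FI.std k) x) = x := fun k hk =>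
    (LinearEquiv.ofBijective _ (hN k hk)).symm_apply_apply
  have hnat : ∀ (j k : ℕ) (hj : j ≤ d) (hk : k ≤ d) (f : FI.std j ⟶ FI.std k) ξ,
      ∀ m : M.obj (FI.std j),
      FI.act M _ _ (Ψ j hj (pullPi N f ξ)) m = FI.act M _ _ (Ψ k hk ξ) ((M.map f).hom m) := by
    intro j k hj hk f ξ m
    rw [← FI.act_precomp]
    congr 2
    rw [← hΨ' j hj (Finsupp.lmapDomain ℤ ℤ (f ≫ ·) (Ψ k hk ξ))]
    congr 1
    funext t
    rw [yonedaPi_precomp, hΨ k hk]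
    rfl
  -- Generators live in degrees `≤ d`, so `ξ` acts on them after being pulled back to their degree.
  let D : ∀ k, (∀ t, (N t).obj (Opposite.op (FI.std k))) →
      (FreeFI R a (FI.std k) →ₗ[R] M.obj (FI.std n)) := fun k ξ =>
    Finsupp.linearCombination R fun p =>
      FI.act M _ _ (Ψ (a p.1) (ha p.1) (pullPi N p.2 ξ)) (g p.1)
  have hD : ∀ k ξ i (f : FI.std (a i) ⟶ FI.std k), D k ξ (Finsupp.single ⟨i, f⟩ 1) =
      FI.act M _ _ (Ψ (a i) (ha i) (pullPi N f ξ)) (g i) := fun k ξ i f => by simp [D]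
  have hDmap : ∀ p q (f : FI.std p ⟶ FI.std q) ξ y,
      D q ξ (FreeFI.map R a f y) = D p (pullPi N f ξ) y := by
    intro p q f ξ y
    suffices D q ξ ∘ₗ FreeFI.map R a f = D p (pullPi N f ξ) from LinearMap.congr_fun this y
    refine FreeFI.hom_ext fun i h => ?_
    rw [LinearMap.comp_apply, FreeFI.map_single, hD, hD, pullPi_comp]
  have hDlow : ∀ k (hk : k ≤ d) ξ y,
      D k ξ y = FI.act M _ _ (Ψ k hk ξ) (FreeFI.desc M a g _ y) := by
    intro k hk ξ y
    suffices D k ξ = FI.act M _ _ (Ψ k hk ξ) ∘ₗ FreeFI.desc M a g _ from LinearMap.congr_fun this y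
    refine FreeFI.hom_ext fun i h => ?_
    rw [LinearMap.comp_apply, FreeFI.desc_single, hD, hnat _ _ (ha i) hk]
  have hr : ∀ j, FreeFI.desc M a g _ (r j) = 0 := by
    intro j
    rw [← LinearMap.mem_ker, hker]
    refine Submodule.subset_span ⟨j, 𝟙 _, ?_⟩
    have : FreeFI.map R a (𝟙 (FI.std (b j))) = LinearMap.id :=
      FreeFI.hom_ext fun i f => by rw [FreeFI.map_single, Category.comp_id]; rfl
    rw [this]
    rfl
  -- Relations also live in degrees `≤ d`, where `D` factors through `M` by `hDlow`.
  have hDker : ∀ k ξ, LinearMap.ker (FreeFI.desc M a g (FI.std k)) ≤ LinearMap.ker (D k ξ) := by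
    intro k ξ
    rw [hker, Submodule.span_le]
    rintro _ ⟨j, f, rfl⟩
    rw [SetLike.mem_coe, LinearMap.mem_ker, hDmap, hDlow _ (hb j), hr, map_zero]
  let E : ∀ k, (∀ t, (N t).obj (Opposite.op (FI.std k))) →
      (M.obj (FI.std k) →ₗ[R] M.obj (FI.std n)) := fun k ξ =>
    Submodule.liftQ _ (D k ξ) (hDker k ξ) ∘ₗ
      (LinearMap.quotKerEquivOfSurjective _ (hsurj (FI.std k))).symm.toLinearMap
  have hE : ∀ k ξ y, E k ξ (FreeFI.desc M a g _ y) = D k ξ y := by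
    intro k ξ y
    have : (LinearMap.quotKerEquivOfSurjective _ (hsurj (FI.std k))).symm
        (FreeFI.desc M a g _ y) = Submodule.Quotient.mk y :=
      (LinearEquiv.symm_apply_eq _).2 rfl
    simp only [E, LinearMap.comp_apply, LinearEquiv.coe_coe, this]
    rfl
  have hDadd : ∀ k ξ ξ', D k (ξ + ξ') = D k ξ + D k ξ' := by
    intro k ξ ξ'
    refine FreeFI.hom_ext fun i f => ?_
    rw [LinearMap.add_apply, hD, hD, hD, map_add, map_add, map_add, LinearMap.add_apply]
  have hEadd : ∀ k ξ ξ', E k (ξ + ξ') = E k ξ + E k ξ' := by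
    intro k ξ ξ'
    refine LinearMap.ext fun m => ?_
    obtain ⟨y, rfl⟩ := hsurj _ m
    rw [LinearMap.add_apply, hE, hE, hE, hDadd, LinearMap.add_apply]
  refine ⟨fun k => AddMonoidHom.mk' (E k) (hEadd k), ?_, ?_, ?_⟩
  · intro p q f m ξ
    obtain ⟨y, rfl⟩ := hsurj _ m
    change E q ξ _ = E p _ _
    rw [← FreeFI.desc_map, hE, hE, hDmap]
  · intro k ξ m t
    obtain ⟨y, rfl⟩ := hsurj _ m
    change toTensorPi M N w (E k ξ _) t = _
    rw [hE]
    suffices LinearMap.proj t ∘ₗ toTensorPi M N w ∘ₗ D k ξ =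
      (TensorFI.mk M (N t) k).flip (ξ t) ∘ₗ FreeFI.desc M a g _ from LinearMap.congr_fun this y
    refine FreeFI.hom_ext fun i f => ?_
    simp only [LinearMap.comp_apply, LinearMap.flip_apply, FreeFI.desc_single, hD,
      LinearMap.proj_apply]
    rw [toTensorPi_act, hΨ _ (ha i), TensorFI.mk_map]
    rfl
  · intro m
    obtain ⟨y, rfl⟩ := hsurj _ m
    change E n w _ = _
    rw [hE]
    suffices D n w = FreeFI.desc M a g _ from LinearMap.congr_fun this y
    refine FreeFI.hom_ext fun i f => ?_
    -- Pulled back to a generator's degree, `w` corresponds to the single injection `f`; no bound on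
    -- `n` is needed.
    have : pullPi N f w = yonedaPi N w _ (Finsupp.single f 1) := by
      simp only [yonedaPi, Finsupp.linearCombination_single, one_smul]
      rfl
    rw [FreeFI.desc_single, hD, this, hΨ' _ (ha i), FI.act_single]

/-- If a family of elements of degree `n` identifies a product of `FI^op`-modules with the
representable module `ℤ FI(-, [n])` in degrees `≤ d`, then it identifies `M_n` with the product of
the tensor products, for all `M` that are presented in degrees `≤ d`. -/
theorem bijective_toTensorPi [Fintype ι] {d : ℕ} (hM : IsPresentedInDegreesLE M d)
    (hN : ∀ k ≤ d, Function.Bijective (yonedaPi N w (FI.std k))) :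
    Function.Bijective (toTensorPi M N w) := by
  classical
  obtain ⟨E, hE, hE', hE''⟩ := exists_hom_of_bijective_yonedaPi N w hM hN
  have hpull : ∀ {p q : ℕ} (f : FI.std p ⟶ FI.std q) (t : ι)
      (ξ : (N t).obj (Opposite.op (FI.std q))),
      pullPi N f (Pi.single t ξ) = Pi.single t (((N t).map f.op).hom ξ) := by
    intro p q f t ξ
    funext t'
    by_cases h : t' = t
    · subst h
      simp [pullPi]
    · simp [pullPi, Pi.single_eq_of_ne h]
  -- The action of families concentrated at `t`. The sum of these maps over all `t` is inverse to
  -- `toTensorPi`.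
  have hθ : ∀ t, ∃ θ : TensorFI M (N t) →ₗ[R] M.obj (FI.std n), ∀ k m ξ,
      θ (TensorFI.mk M (N t) k m ξ) = E k (Pi.single t ξ) m := by
    intro t
    refine TensorFI.exists_lift (fun k => LinearMap.mk₂' R ℤ (fun m ξ => E k (Pi.single t ξ) m)
      (fun m m' ξ => map_add _ _ _) (fun c m ξ => map_smul _ _ _)
      (fun m ξ ξ' => by rw [Pi.single_add, map_add, LinearMap.add_apply])
      (fun c m ξ => map_intCast_smul (((LinearMap.evalAddMonoidHom m).comp (E k)).comp
        (AddMonoidHom.single (fun t => (N t).obj (Opposite.op (FI.std k))) t)) ℤ ℤ c ξ))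
      fun p q f m ξ => ?_
    change E q _ _ = E p _ _
    rw [hE, hpull]
  choose θ hθ using hθ
  have hθ' : ∀ t z, toTensorPi M N w (θ t z) = Pi.single t z := by
    intro t z
    suffices toTensorPi M N w ∘ₗ θ t = LinearMap.single R (fun t => TensorFI M (N t)) t from
      LinearMap.congr_fun this z
    refine TensorFI.hom_ext fun k m ξ => ?_
    rw [LinearMap.comp_apply, hθ, LinearMap.single_apply]
    funext t'
    rw [hE']
    by_cases h : t' = t
    · subst h
      simp
    · simp [Pi.single_eq_of_ne h]
  constructor
  · refine Function.LeftInverse.injective (g := fun z => ∑ t, θ t (z t)) fun m => ?_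
    have h1 : ∀ t, θ t (toTensorPi M N w m t) = E n (Pi.single t (w t)) m := fun t => hθ t n m (w t)
    simp only [h1]
    rw [← LinearMap.sum_apply, ← map_sum, Finset.univ_sum_single, hE'']
  · intro z
    refine ⟨∑ t, θ t (z t), ?_⟩
    simp only [map_sum, hθ']
    exact Finset.univ_sum_single z

end Tensor

/-! The decomposition of `M_n` -/

section Decomposition

variable {R : Type u} [CommRing R] {M : FI ⥤ ModuleCat.{v} R} {d : ℕ}

/-- The number of standard Young tableaux with `n` entries and second row of length `ℓ`. -/
def ballotCount (n ℓ : ℕ) : ℕ := Nat.card {t : Filling n // t.IsBallot ∧ t.deg = ℓ}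

/-- Tableaux are sorted by the length of the second row. -/
def sigmaEquivTableau (n d : ℕ) :
    (Σ ℓ : Fin (d + 1), {t : Filling n // t.IsBallot ∧ t.deg = ℓ}) ≃ Tableau n d where
  toFun σ := ⟨σ.2.1, σ.2.2.1, by have := σ.2.2.2; have := σ.1.2; omega⟩
  invFun t := ⟨⟨t.1.deg, Nat.lt_succ_of_le t.2.2⟩, ⟨t.1, t.2.1, rfl⟩⟩
  left_inv := by
    rintro ⟨⟨ℓ, hℓ⟩, ⟨t, ht, h⟩⟩
    obtain rfl : t.deg = ℓ := h
    rfl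
  right_inv _ := rfl

theorem nonempty_equiv_directSum (hM : IsPresentedInDegreesLE M d) {n : ℕ} (hn : 2 * d ≤ n + 1) :
    Nonempty (M.obj (FI.std n) ≃ₗ[R]
      ⨁ ℓ : Fin (d + 1), (Fin (ballotCount n ℓ) → TailInvariant M ℓ)) := by
  let N : Tableau n d → FIᵒᵖ ⥤ ModuleCat.{0} ℤ := fun t => Xi t.1.deg
  let e₁ : M.obj (FI.std n) ≃ₗ[R] ∀ t : Tableau n d, TailInvariant M t.1.deg :=
    LinearEquiv.ofBijective (toTensorPi M N Tableau.xi)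
      (bijective_toTensorPi N Tableau.xi hM fun k hk => bijective_yonedaPi_xi hn hk)
  let e₂ := (LinearEquiv.piCongrLeft R (fun t : Tableau n d => TailInvariant M t.1.deg)
    (sigmaEquivTableau n d)).symm
  let e₃ : (∀ σ : Σ ℓ : Fin (d + 1), {t : Filling n // t.IsBallot ∧ t.deg = ℓ},
      TailInvariant M (sigmaEquivTableau n d σ).1.deg) ≃ₗ[R]
      ∀ σ : Σ ℓ : Fin (d + 1), {t : Filling n // t.IsBallot ∧ t.deg = ℓ},
        TailInvariant M σ.1 :=
    LinearEquiv.piCongrRight fun σ =>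
      have h : (sigmaEquivTableau n d σ).1.deg = σ.1 := σ.2.2.2
      h ▸ LinearEquiv.refl R _
  let e₄ := LinearEquiv.piCurry R fun (ℓ : Fin (d + 1))
    (_ : {t : Filling n // t.IsBallot ∧ t.deg = ℓ}) => TailInvariant M ℓ
  let e₅ : (∀ ℓ : Fin (d + 1), {t : Filling n // t.IsBallot ∧ t.deg = ℓ} → TailInvariant M ℓ) ≃ₗ[R]
      ∀ ℓ : Fin (d + 1), Fin (ballotCount n ℓ) → TailInvariant M ℓ :=
    LinearEquiv.piCongrRight fun ℓ => LinearEquiv.funCongrLeft R _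
      (Finite.equivFin {t : Filling n // t.IsBallot ∧ t.deg = ℓ}).symm
  exact ⟨e₁ ≪≫ₗ e₂ ≪≫ₗ e₃ ≪≫ₗ e₄ ≪≫ₗ e₅ ≪≫ₗ (DirectSum.linearEquivFunOnFintype R _ _).symm⟩

/-- From `C(n, ℓ + 1) (ℓ + 1) = C(n, ℓ) (n - ℓ)` and `ℓ + 1 < n - ℓ`. -/
theorem binomDiff_pos {n ℓ : ℕ} (h : 2 * ℓ ≤ n) : 0 < binomDiff n ℓ := by
  rcases ℓ with - | ℓ
  · simp [binomDiff]
  · rw [binomDiff, sub_pos, Nat.cast_lt]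
    have h1 := Nat.choose_succ_right_eq n ℓ
    have h2 : 0 < n.choose ℓ := Nat.choose_pos (by omega)
    have h3 : ℓ + 1 < n - ℓ := by omega
    by_contra! h4
    have h5 := Nat.mul_le_mul_right (ℓ + 1) h4
    have h6 := Nat.mul_lt_mul_of_pos_left h3 h2
    omega

theorem ballotCount_pos {n ℓ : ℕ} (h : 2 * ℓ ≤ n) : 0 < ballotCount n ℓ := by
  have h1 := binomDiff_pos h
  rw [← Filling.card_isBallot n ℓ (by omega)] at h1
  exact_mod_cast h1

theorem finite_tailInvariant (hM : IsPresentedInDegreesLE M d)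
    (hfin : ∀ᶠ n : ℕ in atTop, Module.Finite R (M.obj (FI.std n))) (ℓ : Fin (d + 1)) :
    Module.Finite R (TailInvariant M ℓ) := by
  -- With `n ≥ 2d` every multiplicity is positive, so each invariant is a quotient of `M_n`; for `n
  -- = 2d - 1` the top one would have multiplicity zero.
  obtain ⟨n, h1, h2⟩ := (hfin.and (eventually_ge_atTop (2 * d))).exists
  obtain ⟨e⟩ := nonempty_equiv_directSum hM (n := n) (by omega)
  have hpos : 0 < ballotCount n ℓ := ballotCount_pos (by omega)
  have h₁ := LinearMap.proj_surjective (R := R)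
    (φ := fun _ : Fin (ballotCount n ℓ) => TailInvariant M ℓ) ⟨0, hpos⟩
  have h₂ := LinearMap.proj_surjective (R := R)
    (φ := fun ℓ : Fin (d + 1) => Fin (ballotCount n ℓ) → TailInvariant M ℓ) ℓ
  let e' := e ≪≫ₗ DirectSum.linearEquivFunOnFintype R _ _
  exact Module.Finite.of_surjective (LinearMap.proj _ ∘ₗ LinearMap.proj ℓ ∘ₗ e'.toLinearMap)
    (h₁.comp (h₂.comp e'.surjective))

theorem IsField.module_free (hR : IsField R) (V : Type*) [AddCommGroup V] [Module R V] :
    Module.Free R V := by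
  let := hR.toField
  exact Module.Free.of_divisionRing R V

theorem finrank_eq_sum (hR : IsField R) (hM : IsPresentedInDegreesLE M d)
    (hfin : ∀ᶠ n : ℕ in atTop, Module.Finite R (M.obj (FI.std n))) {n : ℕ} (hn : 2 * d ≤ n + 1) :
    (Module.finrank R (M.obj (FI.std n)) : ℤ) =
      ∑ ℓ : Fin (d + 1), binomDiff n ℓ * Module.finrank R (TailInvariant M ℓ) := by
  have := hR.nontrivial
  have (ℓ : Fin (d + 1)) : Module.Free R (TailInvariant M ℓ) := hR.module_free _
  have := finite_tailInvariant hM hfin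
  obtain ⟨e⟩ := nonempty_equiv_directSum hM hn
  rw [e.finrank_eq, Module.finrank_directSum, Nat.cast_sum]
  refine Finset.sum_congr rfl fun ℓ _ => ?_
  rw [Module.finrank_pi_fintype, Finset.sum_const, Finset.card_univ, Fintype.card_fin,
    smul_eq_mul, Nat.cast_mul, ballotCount, Filling.card_isBallot n ℓ (by omega)]

/-! ### The Hilbert polynomial -/

theorem eval_binomPoly (n ℓ : ℕ) : (binomPoly ℓ).eval (n : ℚ) = n.choose ℓ := by
  rw [binomPoly, Polynomial.eval_mul, Polynomial.eval_C, descPochhammer_eval_eq_descFactorial,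
    Nat.descFactorial_eq_factorial_mul_choose, Nat.cast_mul,
    inv_mul_cancel_left₀ (Nat.cast_ne_zero.2 (Nat.factorial_ne_zero ℓ))]

theorem eval_binomDiffPoly (n ℓ : ℕ) : (binomDiffPoly ℓ).eval (n : ℚ) = binomDiff n ℓ := by
  cases ℓ <;> simp [binomDiffPoly, binomDiff, eval_binomPoly]

theorem isHilbertPolynomial_sum (hR : IsField R) (hM : IsPresentedInDegreesLE M d)
    (hfin : ∀ᶠ n : ℕ in atTop, Module.Finite R (M.obj (FI.std n))) :
    IsHilbertPolynomial M
      (∑ ℓ : Fin (d + 1), Module.finrank R (TailInvariant M ℓ) • binomDiffPoly ℓ) := by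
  filter_upwards [eventually_ge_atTop (2 * d)] with n hn
  have h := congrArg (Int.cast : ℤ → ℚ) (finrank_eq_sum hR hM hfin (n := n) (by omega))
  rw [Int.cast_natCast] at h
  rw [h, Polynomial.eval_finsetSum, Int.cast_sum]
  refine Finset.sum_congr rfl fun ℓ _ => ?_
  rw [Polynomial.eval_smul, eval_binomDiffPoly, nsmul_eq_mul, Int.cast_mul, Int.cast_natCast,
    mul_comm]

theorem IsHilbertPolynomial.eq {P Q : ℚ[X]} (hP : IsHilbertPolynomial M P)
    (hQ : IsHilbertPolynomial M Q) : P = Q := by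
  refine Polynomial.eq_of_infinite_eval_eq P Q ?_
  have h : ∃ᶠ n : ℕ in atTop, P.eval (n : ℚ) = Q.eval (n : ℚ) :=
    ((hP.and hQ).mono fun n hn => hn.1.symm.trans hn.2).frequently
  refine ((Nat.frequently_atTop_iff_infinite.1 h).image Nat.cast_injective.injOn).mono ?_
  rintro _ ⟨n, hn, rfl⟩
  exact hn

end Decomposition

end

theorem theoremA {R : Type u} [CommRing R] (M : FI ⥤ ModuleCat.{v} R) (d : ℕ)
    (hM : IsPresentedInDegreesLE M d) :
    (∀ n : ℕ, 2 * (d : ℤ) - 1 ≤ n →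
      ∃ r : Fin (d + 1) → ℕ, (∀ ℓ, (r ℓ : ℤ) = binomDiff n ℓ) ∧
        Nonempty (M.obj (FI.std n) ≃ₗ[R]
          ⨁ ℓ : Fin (d + 1), (Fin (r ℓ) → TailInvariant M ℓ))) ∧
    (IsField R → (∀ᶠ n : ℕ in atTop, Module.Finite R (M.obj (FI.std n))) →
      (∀ ℓ : Fin (d + 1), Module.Finite R (TailInvariant M ℓ)) ∧
      ∀ P : ℚ[X], IsHilbertPolynomial M P ↔
        P = ∑ ℓ : Fin (d + 1), Module.finrank R (TailInvariant M ℓ) • binomDiffPoly ℓ) := by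
  -- The multiplicities count tableaux, which makes the binomial differences nonnegative.
  refine ⟨fun n hn => ⟨fun ℓ => ballotCount n ℓ, fun ℓ => Filling.card_isBallot n ℓ (by omega),
    nonempty_equiv_directSum hM (by omega)⟩, fun hR hfin => ⟨finite_tailInvariant hM hfin, fun P =>
    ⟨fun hP => hP.eq (isHilbertPolynomial_sum hR hM hfin), ?_⟩⟩⟩
  rintro rfl
  exact isHilbertPolynomial_sum hR hM hfin
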